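/- Let $k,d,p\ge 1$ be integers, let $(Y_1,Z_1)$ be a random vector in $\mathbb R^k\times\mathbb R^d$, and let $z\in\mathbb R^d$. Write $\lambda$ for Lebesgue measure, $\langle\cdot,\cdot\rangle$ for the Euclidean scalar product, $|y|_k=\max_i|y_i|$, and let $\mathcal C$ be the class of all unions $C$ of $d$ half-open axis-parallel hypercubes of $\mathbb R^d$ with $\lambda(C)>0$. Assume: (HL1) there is a constant $f(z)>0$ such that $\lim_{h\downarrow0}h^{-1}\,\mathbb P(Z_1\in z+h^{1/d}C)=\lambda(C)f(z)$ for each $C\in\mathcal C$; (HL2) there are maps $\mathcal L_Y:\mathbb R^k\to[0,\infty)$ and $\mathcal L_{|Y|_k}:\mathbb R\to[0,\infty)$ such that, for all $t\in\mathbb R^k$, $t'\in\mathbb R$ and $C\in\mathcal C$, as $h\downarrow0$, $\mathbb E\big(e^{\langle t,Y_1\rangle}\,\big|\,Z_1\in z+h^{1/d}C\big)\to\mathcal L_Y(t)$ and $\mathbb E\big(e^{t'|Y_1|_k}\,\big|\,Z_1\in z+h^{1/d}C\big)\to\mathcal L_{|Y|_k}(t')$. Let $\mathfrak h_Y(u)=\sup_{t\in\mathbb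 R^k}\{\langle t,u\rangle-(\mathcal L_Y(t)-1)\}\in[0,\infty]$ for $u\in\mathbb R^k$. Let $(Y_{ij},Z_{ij})_{i,j\ge1}$ be an i.i.d. array of copies of $(Y_1,Z_1)$, and let $(\eta_i)_{i\ge1}$ be i.i.d. Poisson variables with expectation $1$, the sequence $(\eta_i)$ being independent of the array. For $h>0$, $n\ge1$ and Borel $C\subset\mathbb R^d$ put $$\Delta\Pi_{n}(h,C)=\frac1{nhf(z)}\sum_{i=1}^n\sum_{j=1}^{\eta_i}\mathbf 1_C\!\left(\frac{Z_{ij}-z}{h^{1/d}}\right)Y_{ij}.$$ For $\mathbf j\in\{1,\dots,2^p\}^d$ let $C_{\mathbf j,p}=\prod_{l=1}^d[2^{-p}(j_l-1),2^{-p}j_l)$. Lemma 3.2. For every sequence $(h_n)_{n\ge1}$ with $h_n\to0$ and $nh_n\to\infty$, and every fixed $p\ge1$, the random vectors $$\big(\Delta\Pi_{n}(h_n,C_{\mathbf j,p})\big)_{\mathbf j\in\{1,\dots,2^p\}^d}\in(\mathbb R^k)^{\{1,\dots,2^p\}^d}$$ satisfy the large deviation principle at speed $nh_nf(z)$ with good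 rate function $$J^{(p)}(x)=\sum_{\mathbf j\in\{1,\dots,2^p\}^d}\lambda(C_{\mathbf j,p})\,\mathfrak h_Y\big(\lambda(C_{\mathbf j,p})^{-1}x_{\mathbf j}\big).$$ That is, $nh_nf(z)\to\infty$, the function $J^{(p)}$ is $[0,\infty]$-valued with compact level sets $\{J^{(p)}\le a\}$, $a\in\mathbb R$, and, writing $X_n$ for the above random vector, $$\limsup_{n\to\infty}\frac{\log\mathbb P(X_n\in F)}{nh_nf(z)}\le-\inf_{F}J^{(p)}\ \text{ for every closed }F,\qquad \liminf_{n\to\infty}\frac{\log\mathbb P(X_n\in O)}{nh_nf(z)}\ge-\inf_{O}J^{(p)}\ \text{ for every open }O.$$ -/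

import Mathlib

open MeasureTheory ProbabilityTheory Filter Topology
open scoped NNReal ENNReal

noncomputable section

/-- The half-open hypercube `[a, a + r)` of `ℝ^d` with lower corner `a` and side length `r`. -/
def hypercube {d : ℕ} (a : Fin d → ℝ) (r : ℝ) : Set (Fin d → ℝ) :=
  {x | ∀ l, a l ≤ x l ∧ x l < a l + r}

/-- The class of all unions of `d` hypercubes of `ℝ^d` (not necessarily disjoint or distinct)
that have positive Lebesgue measure. -/
def cubeUnions (d : ℕ) : Set (Set (Fin d → ℝ)) :=
  {C | (∃ (a : Fin d → Fin d → ℝ) (r : Fin d → ℝ), (∀ m, 0 ≤ r m) ∧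
      C = ⋃ m, hypercube (a m) (r m)) ∧ 0 < volume C}

/-- The set `z + h^{1/d} C`. -/
def shrink {d : ℕ} (z : Fin d → ℝ) (h : ℝ) (C : Set (Fin d → ℝ)) : Set (Fin d → ℝ) :=
  (fun c => z + (h ^ (1 / (d : ℝ))) • c) '' C

/-- Assumption (HL1): `fz > 0` and `h⁻¹ P(Z ∈ z + h^{1/d} C) → λ(C) fz` as `h ↓ 0`,
for each `C` in the class `cubeUnions d`. -/
def HL1 {Ω : Type*} [MeasurableSpace Ω] (P : Measure Ω) {d : ℕ}
    (Z : Ω → Fin d → ℝ) (z : Fin d → ℝ) (fz : ℝ) : Prop :=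
  0 < fz ∧ ∀ C ∈ cubeUnions d,
    Tendsto (fun h : ℝ => h⁻¹ * P.real (Z ⁻¹' shrink z h C)) (𝓝[>] 0)
      (𝓝 (volume.real C * fz))

/-- Assumption (HL2): the conditional exponential moments of `Y` and of `|Y|_k` given
`Z ∈ z + h^{1/d} C` converge, as `h ↓ 0`, to the finite limits `LY` and `LabsY`, which do not
depend on `C`. Expectations of nonnegative variables are Lebesgue integrals with values in
`[0, ∞]`, so no integrability is presupposed; the norm on `Fin k → ℝ` is the maximum norm. -/
def HL2 {Ω : Type*} [MeasurableSpace Ω] (P : Measure Ω) {k d : ℕ}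
    (Y : Ω → Fin k → ℝ) (Z : Ω → Fin d → ℝ) (z : Fin d → ℝ)
    (LY : (Fin k → ℝ) → ℝ≥0) (LabsY : ℝ → ℝ≥0) : Prop :=
  ∀ C ∈ cubeUnions d,
    (∀ t : Fin k → ℝ,
      Tendsto (fun h : ℝ => ∫⁻ ω, ENNReal.ofReal (Real.exp (t ⬝ᵥ Y ω))
        ∂(cond P (Z ⁻¹' shrink z h C))) (𝓝[>] 0) (𝓝 (LY t : ℝ≥0∞))) ∧
    (∀ t' : ℝ,
      Tendsto (fun h : ℝ => ∫⁻ ω, ENNReal.ofReal (Real.exp (t' * ‖Y ω‖))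
        ∂(cond P (Z ⁻¹' shrink z h C))) (𝓝[>] 0) (𝓝 (LabsY t' : ℝ≥0∞)))

/-- The Legendre transform of `L - 1`, with values in the extended reals. -/
def legendre {k : ℕ} (L : (Fin k → ℝ) → ℝ≥0) (u : Fin k → ℝ) : EReal :=
  ⨆ t : Fin k → ℝ, ((t ⬝ᵥ u - ((L t : ℝ) - 1) : ℝ) : EReal)

/-- The dyadic cell `∏ [2^{-p} j_l, 2^{-p} (j_l + 1))`, with `j_l ∈ {0, …, 2^p - 1}`. -/
def dyadicCell {d : ℕ} (p : ℕ) (j : Fin d → Fin (2 ^ p)) : Set (Fin d → ℝ) :=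
  {s | ∀ l, ((j l : ℕ) : ℝ) / 2 ^ p ≤ s l ∧ s l < (((j l : ℕ) : ℝ) + 1) / 2 ^ p}

/-- The data of the Poissonised process: an i.i.d. array `(Y i j, Z i j)` of copies of `(Y₁, Z₁)`
and an i.i.d. sequence `η i` of Poisson variables with expectation one, the sequence being
independent of the array. -/
structure IsPoissonArray {Ω Ω₀ : Type*} [MeasurableSpace Ω] [MeasurableSpace Ω₀]
    (P : Measure Ω) (P₀ : Measure Ω₀) {k d : ℕ}
    (Y₁ : Ω₀ → Fin k → ℝ) (Z₁ : Ω₀ → Fin d → ℝ)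
    (Y : ℕ → ℕ → Ω → Fin k → ℝ) (Z : ℕ → ℕ → Ω → Fin d → ℝ) (η : ℕ → Ω → ℕ) : Prop where
  measurable_Y : ∀ i j, Measurable (Y i j)
  measurable_Z : ∀ i j, Measurable (Z i j)
  measurable_η : ∀ i, Measurable (η i)
  identDistrib : ∀ i j,
    IdentDistrib (fun ω => (Y i j ω, Z i j ω)) (fun ω => (Y₁ ω, Z₁ ω)) P P₀
  iIndep_array : iIndepFun (fun (q : ℕ × ℕ) ω => (Y q.1 q.2 ω, Z q.1 q.2 ω)) P
  law_η : ∀ i, P.map (η i) = poissonMeasure 1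
  iIndep_η : iIndepFun η P
  indep : IndepFun (fun ω (i : ℕ) => η i ω)
    (fun ω (q : ℕ × ℕ) => (Y q.1 q.2 ω, Z q.1 q.2 ω)) P

/-- The increment `U(A)` over the set `A` of the compound Poisson process
`U(s) = ∑_{j ≤ N} 1_{[0,s)}(Z_j - z) Y_j`, for given values `N`, `Y_j`, `Z_j`. -/
def compoundIncrement {k d : ℕ} (z : Fin d → ℝ) (N : ℕ) (Y : ℕ → Fin k → ℝ)
    (Z : ℕ → Fin d → ℝ) (A : Set (Fin d → ℝ)) : Fin k → ℝ :=
  ∑ j ∈ Finset.range N, A.indicator (fun _ => Y j) (Z j - z)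

/-- The Poissonised increment
`ΔΠ_n(h, C) = (n h f(z))⁻¹ ∑_{i ≤ n} ∑_{j ≤ η_i} 1_C((Z_{ij} - z) / h^{1/d}) Y_{ij}`,
which is `(n h f(z))⁻¹ ∑_{i ≤ n} U_i(h^{1/d} C)`. -/
def poissonIncrement {Ω : Type*} {k d : ℕ} (z : Fin d → ℝ) (fz : ℝ)
    (Y : ℕ → ℕ → Ω → Fin k → ℝ) (Z : ℕ → ℕ → Ω → Fin d → ℝ) (η : ℕ → Ω → ℕ)
    (n : ℕ) (h : ℝ) (C : Set (Fin d → ℝ)) (ω : Ω) : Fin k → ℝ :=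
  ((n : ℝ) * h * fz)⁻¹ • ∑ i ∈ Finset.range n,
    compoundIncrement z (η i ω) (fun j => Y i j ω) (fun j => Z i j ω) (shrink 0 h C)

/-- The large deviation principle for the random elements `X n` at speed `(ε n)⁻¹ → ∞`
with rate function `J`, which is required to be `[0, ∞]`-valued with compact level sets. -/
structure SatisfiesLDP {Ω E : Type*} [MeasurableSpace Ω] [TopologicalSpace E]
    (P : Measure Ω) (X : ℕ → Ω → E) (ε : ℕ → ℝ) (J : E → EReal) : Prop where
  speed_pos : ∀ᶠ n in atTop, 0 < ε n
  speed_tendsto : Tendsto ε atTop (𝓝 0)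
  rate_nonneg : ∀ x, 0 ≤ J x
  rate_compact : ∀ a : ℝ, IsCompact {x | J x ≤ (a : EReal)}
  upper_bound : ∀ F : Set E, IsClosed F →
    limsup (fun n => (ε n : EReal) * ENNReal.log (P (X n ⁻¹' F))) atTop ≤ -(⨅ x ∈ F, J x)
  lower_bound : ∀ O : Set E, IsOpen O →
    -(⨅ x ∈ O, J x) ≤ liminf (fun n => (ε n : EReal) * ENNReal.log (P (X n ⁻¹' O))) atTop

/-- The rate function `x ↦ ∑_j λ(C_j) 𝔥(λ(C_j)⁻¹ x_j)`, where `𝔥` is the Legendre transform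
of `L - 1`. -/
def cellRate {k : ℕ} (d p : ℕ) (L : (Fin k → ℝ) → ℝ≥0)
    (x : (Fin d → Fin (2 ^ p)) → Fin k → ℝ) : EReal :=
  ∑ j, ((volume.real (dyadicCell p j) : ℝ) : EReal) *
    legendre L ((volume.real (dyadicCell p j))⁻¹ • x j)

end

/-! The proof is a Gärtner–Ellis argument. For a compound Poisson sum, `log E exp ⟨t, nhf·X_n⟩` is
exactly `n(m - 1)`, where `m` is the moment of one sample point
(`IsPoissonArray.lintegral_prod_range`). The cells are disjoint, so `m - 1` is a sum over cells of
`P(Z ∈ cell)` times the conditional exponential moment minus one (`lintegral_exp_sum_indicator`).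
After division by `nhf`, (HL1) and (HL2) give the limit `∑ λ(C_j)(L(t_j) - 1)`. This function is
separable, so its conjugate is the stated rate (`convexConjugate_cellCumulant`).

The upper bound needs only Chernoff bounds and compactness. The lower bound tilts the law by a
suitable `t`. Differentiability of `Λ` is replaced by two one-sided estimates: a quadratically
penalised maximisation of `⟨t, x⟩ - Λ t` gives a quadratic minorant of `Λ` at `t` with slope `y`
near `x` (`exists_approximate_subgradient`), and a bound on symmetric second differences turns it
into an upper estimate (`exists_smul_sub_lt`). Together they make the tilted law concentrate near
`y`. The second-difference bound holds because `L` is a limit of Laplace transforms. -/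

/-- The convex conjugate of `Λ`, with values in the extended reals. -/
noncomputable def convexConjugate {ι : Type*} [Fintype ι] (Λ : (ι → ℝ) → ℝ) (x : ι → ℝ) : EReal :=
  ⨆ t : ι → ℝ, ((t ⬝ᵥ x - Λ t : ℝ) : EReal)

/-- The scaled cumulant generating functions of `X n` at scale `ε n` exist for large `n` and
converge pointwise to `Λ`. -/
structure HasCumulantLimit {Ω ι : Type*} [MeasurableSpace Ω] [Fintype ι] (P : Measure Ω)
    (X : ℕ → Ω → ι → ℝ) (ε : ℕ → ℝ) (Λ : (ι → ℝ) → ℝ) : Prop where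
  measurable : ∀ n, Measurable (X n)
  scale_pos : ∀ᶠ n in atTop, 0 < ε n
  scale_tendsto : Tendsto ε atTop (𝓝 0)
  cumulant : ∀ t, ∃ c : ℕ → ℝ, Tendsto c atTop (𝓝 (Λ t)) ∧ ∀ᶠ n in atTop,
    ∫⁻ ω, ENNReal.ofReal (Real.exp (t ⬝ᵥ X n ω / ε n)) ∂P = ENNReal.ofReal (Real.exp (c n / ε n))

/-! ### Exponential scale: passing between probabilities and scaled logarithms. -/

section LogScale

lemma EReal.coe_mul_log_le {e a : ℝ} {q : ℝ≥0∞} (he : 0 < e)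
    (h : q ≤ ENNReal.ofReal (Real.exp (a / e))) : (e : EReal) * ENNReal.log q ≤ a := by
  have h1 := ENNReal.log_le_log h
  rw [ENNReal.log_ofReal_of_pos (Real.exp_pos _), Real.log_exp] at h1
  calc (e : EReal) * ENNReal.log q ≤ (e : EReal) * ((a / e : ℝ) : EReal) :=
        mul_le_mul_of_nonneg_left h1 (by exact_mod_cast he.le)
    _ = a := by rw [← EReal.coe_mul, mul_div_cancel₀ _ he.ne']

lemma EReal.le_coe_mul_log {e a : ℝ} {q : ℝ≥0∞} (he : 0 < e)
    (h : ENNReal.ofReal (Real.exp (a / e)) ≤ q) : (a : EReal) ≤ (e : EReal) * ENNReal.log q := by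
  have h1 := ENNReal.log_le_log h
  rw [ENNReal.log_ofReal_of_pos (Real.exp_pos _), Real.log_exp] at h1
  calc (a : EReal) = (e : EReal) * ((a / e : ℝ) : EReal) := by
        rw [← EReal.coe_mul, mul_div_cancel₀ _ he.ne']
    _ ≤ (e : EReal) * ENNReal.log q := mul_le_mul_of_nonneg_left h1 (by exact_mod_cast he.le)

lemma tendsto_const_div_atTop {ε : ℕ → ℝ} (hp : ∀ᶠ n in atTop, 0 < ε n)
    (h0 : Tendsto ε atTop (𝓝 0)) {δ : ℝ} (hδ : 0 < δ) :
    Tendsto (fun n => δ / ε n) atTop atTop := by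
  have : Tendsto ε atTop (𝓝[>] 0) := tendsto_nhdsWithin_iff.2 ⟨h0, hp⟩
  simpa [div_eq_mul_inv] using (tendsto_inv_nhdsGT_zero.comp this).const_mul_atTop hδ

lemma eventually_le_exp_div {ε : ℕ → ℝ} (hp : ∀ᶠ n in atTop, 0 < ε n)
    (h0 : Tendsto ε atTop (𝓝 0)) {δ : ℝ} (hδ : 0 < δ) (N : ℝ) :
    ∀ᶠ n in atTop, N ≤ Real.exp (δ / ε n) :=
  (Real.tendsto_exp_atTop.comp (tendsto_const_div_atTop hp h0 hδ)).eventually_ge_atTop N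

end LogScale

/-! ### Chernoff bounds and exponential tilting. -/

namespace HasCumulantLimit

variable {Ω ι : Type*} [MeasurableSpace Ω] [Fintype ι] {P : Measure Ω}
  {X : ℕ → Ω → ι → ℝ} {ε : ℕ → ℝ} {Λ : (ι → ℝ) → ℝ}

lemma measurable_dotProduct (hX : HasCumulantLimit P X ε Λ) (t : ι → ℝ) (n : ℕ) :
    Measurable fun ω => t ⬝ᵥ X n ω := by
  have := fun i => (measurable_pi_iff.1 (hX.measurable n)) i
  unfold dotProduct
  fun_prop

/-- Markov's inequality for `exp (⟨t, X n⟩ / ε n)`; `δ` absorbs the difference between the actual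
cumulant and its limit. -/
lemma measure_halfSpace_le (hX : HasCumulantLimit P X ε Λ) (t : ι → ℝ) (b : ℝ) {δ : ℝ}
    (hδ : 0 < δ) : ∀ᶠ n in atTop,
      P {ω | b ≤ t ⬝ᵥ X n ω - Λ t} ≤ ENNReal.ofReal (Real.exp ((δ - b) / ε n)) := by
  obtain ⟨c, hc, hm⟩ := hX.cumulant t
  filter_upwards [hX.scale_pos, hm, hc.eventually_le_const (lt_add_of_pos_right _ hδ)]
    with n hn hm hc
  have hmk := mul_meas_ge_le_lintegral (μ := P)
    (f := fun ω => ENNReal.ofReal (Real.exp (t ⬝ᵥ X n ω / ε n)))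
    ((((hX.measurable_dotProduct t n).div_const _).exp).ennreal_ofReal)
    (ENNReal.ofReal (Real.exp ((b + Λ t) / ε n)))
  rw [hm] at hmk
  have hs : {ω | b ≤ t ⬝ᵥ X n ω - Λ t} ⊆ {ω | ENNReal.ofReal (Real.exp ((b + Λ t) / ε n)) ≤
      ENNReal.ofReal (Real.exp (t ⬝ᵥ X n ω / ε n))} := by
    intro ω hω
    refine ENNReal.ofReal_le_ofReal (Real.exp_le_exp.2 ?_)
    have : b ≤ t ⬝ᵥ X n ω - Λ t := hω
    gcongr
    linarith
  have hpos : 0 < Real.exp ((b + Λ t) / ε n) := Real.exp_pos _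
  calc P {ω | b ≤ t ⬝ᵥ X n ω - Λ t} ≤ _ := measure_mono hs
    _ ≤ ENNReal.ofReal (Real.exp (c n / ε n)) / ENNReal.ofReal (Real.exp ((b + Λ t) / ε n)) := by
        rw [ENNReal.le_div_iff_mul_le (Or.inl (by simpa using hpos)) (Or.inl (by simp)), mul_comm]
        exact hmk
    _ = ENNReal.ofReal (Real.exp ((c n - b - Λ t) / ε n)) := by
        rw [← ENNReal.ofReal_div_of_pos hpos, ← Real.exp_sub]
        congr 2; ring
    _ ≤ _ := ENNReal.ofReal_le_ofReal (Real.exp_le_exp.2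
        (div_le_div_of_nonneg_right (by linarith) hn.le))

lemma measure_biUnion_halfSpace_le (hX : HasCumulantLimit P X ε Λ) (T : Finset (ι → ℝ)) (b : ℝ)
    {δ : ℝ} (hδ : 0 < δ) : ∀ᶠ n in atTop,
      P (⋃ t ∈ T, {ω | b ≤ t ⬝ᵥ X n ω - Λ t}) ≤ ENNReal.ofReal (Real.exp ((δ - b) / ε n)) := by
  have hall : ∀ᶠ n in atTop, ∀ t ∈ T,
      P {ω | b ≤ t ⬝ᵥ X n ω - Λ t} ≤ ENNReal.ofReal (Real.exp ((δ / 2 - b) / ε n)) :=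
    -- Half of `δ` goes to the Chernoff bounds, the other half pays for the cardinality of `T` in
    -- the union bound.
    (Filter.eventually_all_finset T).2 fun t _ => hX.measure_halfSpace_le t b (half_pos hδ)
  filter_upwards [hall, eventually_le_exp_div hX.scale_pos hX.scale_tendsto (half_pos hδ) T.card]
    with n hn hT
  calc P (⋃ t ∈ T, {ω | b ≤ t ⬝ᵥ X n ω - Λ t})
      ≤ ∑ t ∈ T, P {ω | b ≤ t ⬝ᵥ X n ω - Λ t} := measure_biUnion_finset_le _ _
    _ ≤ ∑ t ∈ T, ENNReal.ofReal (Real.exp ((δ / 2 - b) / ε n)) := Finset.sum_le_sum hn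
    _ = ENNReal.ofReal (T.card * Real.exp ((δ / 2 - b) / ε n)) := by
        rw [Finset.sum_const, nsmul_eq_mul, ENNReal.ofReal_mul (by positivity),
          ENNReal.ofReal_natCast]
    _ ≤ ENNReal.ofReal (Real.exp (δ / 2 / ε n) * Real.exp ((δ / 2 - b) / ε n)) := by gcongr
    _ = _ := by
        rw [← Real.exp_add]
        congr 2; ring

/-- Under the measure tilted by `t`, the half-space `{a ≤ ⟨u, x⟩}` is negligible. -/
lemma setLIntegral_halfSpace_le (hX : HasCumulantLimit P X ε Λ) {t u : ι → ℝ} {a κ : ℝ}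
    (ha : Λ (t + u) - Λ t < a) (hκ : 0 < κ) : ∀ᶠ n in atTop,
      ∫⁻ ω in {ω | a ≤ u ⬝ᵥ X n ω}, ENNReal.ofReal (Real.exp (t ⬝ᵥ X n ω / ε n)) ∂P ≤
        ENNReal.ofReal κ * ∫⁻ ω, ENNReal.ofReal (Real.exp (t ⬝ᵥ X n ω / ε n)) ∂P := by
  obtain ⟨c, hc, hm⟩ := hX.cumulant t
  obtain ⟨c', hc', hm'⟩ := hX.cumulant (t + u)
  obtain ⟨θ, hθ, hθa⟩ : ∃ θ > 0, Λ (t + u) - Λ t + θ < a :=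
    ⟨(a - (Λ (t + u) - Λ t)) / 2, by linarith, by linarith⟩
  have hlim : Tendsto (fun n => c' n - c n + θ) atTop (𝓝 (Λ (t + u) - Λ t + θ)) :=
    (hc'.sub hc).add_const _
  filter_upwards [hX.scale_pos, hm, hm', hlim.eventually_le_const hθa,
    eventually_le_exp_div hX.scale_pos hX.scale_tendsto hθ κ⁻¹] with n hn hm hm' hle hexp
  have hκ' : Real.exp (-(θ / ε n)) ≤ κ := by
    rw [Real.exp_neg]
    exact inv_le_of_inv_le₀ hκ hexp
  -- On the half-space the factor `exp ((⟨u, X n⟩ - a) / ε n)` is at least one; inserting it moves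
  -- the tilt from `t` to `t + u`.
  calc ∫⁻ ω in {ω | a ≤ u ⬝ᵥ X n ω}, ENNReal.ofReal (Real.exp (t ⬝ᵥ X n ω / ε n)) ∂P
      ≤ ∫⁻ ω in {ω | a ≤ u ⬝ᵥ X n ω}, ENNReal.ofReal (Real.exp (-a / ε n)) *
          ENNReal.ofReal (Real.exp ((t + u) ⬝ᵥ X n ω / ε n)) ∂P := by
        refine setLIntegral_mono' (measurableSet_le measurable_const
          (hX.measurable_dotProduct u n)) fun ω hω => ?_
        have : a ≤ u ⬝ᵥ X n ω := hω
        rw [← ENNReal.ofReal_mul (Real.exp_nonneg _), ← Real.exp_add, ← add_div, add_dotProduct]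
        refine ENNReal.ofReal_le_ofReal (Real.exp_le_exp.2 ?_)
        gcongr
        linarith
    _ ≤ ∫⁻ ω, ENNReal.ofReal (Real.exp (-a / ε n)) *
          ENNReal.ofReal (Real.exp ((t + u) ⬝ᵥ X n ω / ε n)) ∂P := setLIntegral_le_lintegral _ _
    _ = ENNReal.ofReal (Real.exp ((c' n - a) / ε n)) := by
        rw [lintegral_const_mul' _ _ ENNReal.ofReal_ne_top, hm',
          ← ENNReal.ofReal_mul (Real.exp_nonneg _), ← Real.exp_add]
        congr 2; ring
    _ ≤ ENNReal.ofReal (Real.exp (-(θ / ε n)) * Real.exp (c n / ε n)) := by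
        rw [← Real.exp_add, ← neg_div, ← add_div]
        refine ENNReal.ofReal_le_ofReal (Real.exp_le_exp.2 ?_)
        gcongr
        linarith
    _ ≤ _ := by
        rw [hm, ← ENNReal.ofReal_mul hκ.le]
        gcongr

/-- The complement of the polyhedron is a finite union of half-spaces, each negligible under the
tilted measure. -/
lemma half_lintegral_le_setLIntegral (hX : HasCumulantLimit P X ε Λ) {κ : Type*} [Fintype κ]
    {t : ι → ℝ} {u : κ → ι → ℝ} {a : κ → ℝ} (ha : ∀ k, Λ (t + u k) - Λ t < a k) :
    ∀ᶠ n in atTop, 2⁻¹ * ∫⁻ ω, ENNReal.ofReal (Real.exp (t ⬝ᵥ X n ω / ε n)) ∂P ≤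
      ∫⁻ ω in {ω | ∀ k, u k ⬝ᵥ X n ω < a k}, ENNReal.ofReal (Real.exp (t ⬝ᵥ X n ω / ε n)) ∂P := by
  set N : ℝ := 2 * (Fintype.card κ + 1)
  have hN : 0 < N := by positivity
  obtain ⟨c, -, hm⟩ := hX.cumulant t
  filter_upwards [hm, eventually_all.2
    fun k => hX.setLIntegral_halfSpace_le (ha k) (inv_pos.2 hN)] with n hm hk
  set f := fun ω => ENNReal.ofReal (Real.exp (t ⬝ᵥ X n ω / ε n))
  set I := ∫⁻ ω, f ω ∂P
  set S := {ω | ∀ k, u k ⬝ᵥ X n ω < a k}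
  have hI : I ≠ ∞ := by rw [hm]; exact ENNReal.ofReal_ne_top
  have hS : MeasurableSet S := by
    have : S = ⋂ k, {ω | u k ⬝ᵥ X n ω < a k} := by ext; simp [S]
    rw [this]
    exact MeasurableSet.iInter fun k =>
      measurableSet_lt (hX.measurable_dotProduct _ _) measurable_const
  have hc : ∫⁻ ω in Sᶜ, f ω ∂P ≤ 2⁻¹ * I := by
    have hsub : Sᶜ ⊆ ⋃ k, {ω | a k ≤ u k ⬝ᵥ X n ω} := by
      intro ω hω
      simpa [S] using hω
    calc ∫⁻ ω in Sᶜ, f ω ∂P ≤ ∫⁻ ω in ⋃ k, {ω | a k ≤ u k ⬝ᵥ X n ω}, f ω ∂P :=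
          lintegral_mono_set hsub
      _ ≤ ∑' k, ∫⁻ ω in {ω | a k ≤ u k ⬝ᵥ X n ω}, f ω ∂P := lintegral_iUnion_le _ _
      _ ≤ ∑' _ : κ, ENNReal.ofReal N⁻¹ * I := ENNReal.tsum_le_tsum hk
      _ = ENNReal.ofReal (Fintype.card κ * N⁻¹) * I := by
          rw [tsum_fintype, Finset.sum_const, nsmul_eq_mul, Finset.card_univ,
            ENNReal.ofReal_mul (by positivity), ENNReal.ofReal_natCast, mul_assoc]
      _ ≤ ENNReal.ofReal 2⁻¹ * I := by
          gcongr
          rw [← div_eq_mul_inv, div_le_iff₀ hN]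
          simp only [N]
          linarith
      _ = 2⁻¹ * I := by rw [ENNReal.ofReal_inv_of_pos two_pos]; simp
  have hsplit := lintegral_add_compl (μ := P) f hS
  have hhalf : 2⁻¹ * I ≠ ∞ := ENNReal.mul_ne_top (by simp) hI
  refine (ENNReal.add_le_add_iff_right hhalf).1 ?_
  calc 2⁻¹ * I + 2⁻¹ * I = I := by rw [← add_mul, ENNReal.inv_two_add_inv_two, one_mul]
    _ = _ := hsplit.symm
    _ ≤ _ := by gcongr

/-- The exponential change of measure: a lower bound for the probability of a polyhedron which
carries the measure tilted by `t`. -/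
lemma le_measure_polyhedron (hX : HasCumulantLimit P X ε Λ) {κ : Type*} [Fintype κ]
    {t : ι → ℝ} {u : κ → ι → ℝ} {a : κ → ℝ} (ha : ∀ k, Λ (t + u k) - Λ t < a k) {b δ : ℝ}
    (hb : ∀ x, (∀ k, u k ⬝ᵥ x < a k) → t ⬝ᵥ x ≤ b) (hδ : 0 < δ) :
    ∀ᶠ n in atTop, ENNReal.ofReal (Real.exp ((Λ t - b - δ) / ε n)) ≤
      P {ω | ∀ k, u k ⬝ᵥ X n ω < a k} := by
  obtain ⟨c, hc, hm⟩ := hX.cumulant t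
  filter_upwards [hX.scale_pos, hm, hX.half_lintegral_le_setLIntegral ha,
    eventually_le_exp_div hX.scale_pos hX.scale_tendsto (half_pos hδ) 2,
    hc.eventually_const_le (sub_lt_self (Λ t) (half_pos hδ))] with n hn hm hhalf hexp hc
  have hpos : 0 < Real.exp (b / ε n) := Real.exp_pos _
  rw [hm] at hhalf
  have hup : ∫⁻ ω in {ω | ∀ k, u k ⬝ᵥ X n ω < a k}, ENNReal.ofReal (Real.exp (t ⬝ᵥ X n ω / ε n)) ∂P
      ≤ ENNReal.ofReal (Real.exp (b / ε n)) * P {ω | ∀ k, u k ⬝ᵥ X n ω < a k} := by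
    rw [← setLIntegral_const]
    refine setLIntegral_mono measurable_const fun ω hω => ?_
    refine ENNReal.ofReal_le_ofReal (Real.exp_le_exp.2 ?_)
    gcongr
    exact hb _ hω
  have h2 : ENNReal.ofReal (Real.exp (b / ε n)) * ENNReal.ofReal (Real.exp ((Λ t - b - δ) / ε n)) ≤
      2⁻¹ * ENNReal.ofReal (Real.exp (c n / ε n)) := by
    have : (2 : ℝ≥0∞)⁻¹ = ENNReal.ofReal 2⁻¹ := by
      rw [ENNReal.ofReal_inv_of_pos two_pos]; simp
    rw [this, ← ENNReal.ofReal_mul hpos.le, ← ENNReal.ofReal_mul (by norm_num), ← Real.exp_add]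
    refine ENNReal.ofReal_le_ofReal ?_
    -- One half of `δ` absorbs the factor two, the other the error `Λ t - c n`.
    rw [le_inv_mul_iff₀ two_pos]
    calc 2 * Real.exp (b / ε n + (Λ t - b - δ) / ε n)
        ≤ Real.exp (δ / 2 / ε n) * Real.exp (b / ε n + (Λ t - b - δ) / ε n) := by gcongr
      _ ≤ Real.exp (c n / ε n) := by
          rw [← Real.exp_add, ← add_div, ← add_div]
          refine Real.exp_le_exp.2 ?_
          gcongr
          linarith
  exact (ENNReal.mul_le_mul_iff_right (by simpa using hpos) ENNReal.ofReal_ne_top).1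
    (h2.trans (hhalf.trans hup))

end HasCumulantLimit

/-! ### Convex conjugates and approximate subgradients. -/

section ConvexConjugate

variable {ι : Type*} [Fintype ι] {Λ : (ι → ℝ) → ℝ}

lemma convexConjugate_le_coe_iff {x : ι → ℝ} {a : ℝ} :
    convexConjugate Λ x ≤ a ↔ ∀ t, t ⬝ᵥ x - Λ t ≤ a := by
  simp only [convexConjugate, iSup_le_iff, EReal.coe_le_coe_iff]

lemma coe_lt_convexConjugate_iff {x : ι → ℝ} {a : ℝ} :
    a < convexConjugate Λ x ↔ ∃ t, a < t ⬝ᵥ x - Λ t := by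
  simp only [convexConjugate, lt_iSup_iff, EReal.coe_lt_coe_iff]

lemma convexConjugate_nonneg (h0 : Λ 0 = 0) (x : ι → ℝ) : 0 ≤ convexConjugate Λ x :=
  le_iSup_of_le 0 (by simp [h0])

/-- Outside of a compact cube, the conjugate is controlled by finitely many slopes. -/
lemma exists_finset_forall_lt_of_norm_lt (Λ : (ι → ℝ) → ℝ) (a : ℝ) :
    ∃ (T : Finset (ι → ℝ)) (M : ℝ), 0 ≤ M ∧ ∀ x, M < ‖x‖ → ∃ t ∈ T, a < t ⬝ᵥ x - Λ t := by
  classical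
  -- The slopes `±e_i` suffice because the norm is the maximum norm.
  let T : Finset (ι → ℝ) := Finset.univ.image (fun i => Pi.single i (1 : ℝ)) ∪
    Finset.univ.image (fun i => Pi.single i (-1 : ℝ))
  obtain ⟨M₀, hM₀⟩ := (T.image Λ).bddAbove
  refine ⟨T, max 0 (a + M₀), le_max_left _ _, fun x hx => ?_⟩
  have hM : ∀ t ∈ T, Λ t ≤ M₀ := fun t ht => hM₀ (by
    simpa using ⟨t, ht, rfl⟩)
  obtain ⟨i, hi⟩ : ∃ i, max 0 (a + M₀) < ‖x i‖ := by
    by_contra! h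
    exact absurd ((pi_norm_le_iff_of_nonneg (le_max_left _ _)).2 h) (not_le.2 hx)
  have hi' : a + M₀ < |x i| := (le_max_right _ _).trans_lt hi
  have hp : Pi.single i (1 : ℝ) ∈ T := by simp [T]
  have hm : Pi.single i (-1 : ℝ) ∈ T := by simp [T]
  rcases lt_abs.1 hi' with h | h
  · exact ⟨_, hp, by rw [single_dotProduct]; linarith [hM _ hp]⟩
  · exact ⟨_, hm, by rw [single_dotProduct]; linarith [hM _ hm]⟩

lemma continuous_dotProduct_sub (t : ι → ℝ) : Continuous fun x : ι → ℝ => t ⬝ᵥ x - Λ t := by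
  unfold dotProduct
  fun_prop

lemma isCompact_convexConjugate_le (a : ℝ) : IsCompact {x | convexConjugate Λ x ≤ a} := by
  obtain ⟨T, M, -, hT⟩ := exists_finset_forall_lt_of_norm_lt Λ a
  refine Metric.isCompact_of_isClosed_isBounded ?_ ?_
  · simp only [convexConjugate_le_coe_iff, Set.ofPred_forall]
    exact isClosed_iInter fun t => isClosed_le (continuous_dotProduct_sub t) continuous_const
  · refine (Metric.isBounded_closedBall (x := (0 : ι → ℝ)) (r := M)).subset fun x hx => ?_
    rw [mem_closedBall_zero_iff]
    by_contra! h
    obtain ⟨t, -, ht⟩ := hT x h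
    exact absurd (convexConjugate_le_coe_iff.1 hx t) (not_le.2 ht)

/-- Finitely many slopes handle the part of `F` outside a large ball; the remaining part is compact
and covered by open half-spaces. -/
lemma exists_finset_cover_halfSpaces {F : Set (ι → ℝ)} (hF : IsClosed F) {a : ℝ}
    (ha : ∀ x ∈ F, (a : EReal) < convexConjugate Λ x) :
    ∃ T : Finset (ι → ℝ), ∀ x ∈ F, ∃ t ∈ T, a < t ⬝ᵥ x - Λ t := by
  classical
  obtain ⟨T, M, -, hT⟩ := exists_finset_forall_lt_of_norm_lt Λ a
  have hK : IsCompact (Metric.closedBall (0 : ι → ℝ) M ∩ F) :=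
    (isCompact_closedBall _ _).inter_right hF
  obtain ⟨T', hT'⟩ := hK.elim_finite_subcover (fun t : ι → ℝ => {x | a < t ⬝ᵥ x - Λ t})
    (fun t => isOpen_lt continuous_const (continuous_dotProduct_sub t))
    (fun x hx => by simpa using coe_lt_convexConjugate_iff.1 (ha x hx.2))
  refine ⟨T ∪ T', fun x hx => ?_⟩
  rcases lt_or_ge M ‖x‖ with h | h
  · obtain ⟨t, ht, h⟩ := hT x h
    exact ⟨t, Finset.mem_union_left _ ht, h⟩
  · have := hT' ⟨by simpa using h, hx⟩
    simp only [Set.mem_iUnion, Set.mem_ofPred_eq] at this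
    obtain ⟨t, ht, h⟩ := this
    exact ⟨t, Finset.mem_union_right _ ht, h⟩

lemma norm_sq_le_dotProduct_self (t : ι → ℝ) : ‖t‖ ^ 2 ≤ t ⬝ᵥ t := by
  have h0 : 0 ≤ t ⬝ᵥ t := Finset.sum_nonneg fun i _ => mul_self_nonneg _
  refine (Real.le_sqrt (norm_nonneg _) h0).1 ((pi_norm_le_iff_of_nonneg (Real.sqrt_nonneg _)).2
    fun i => Real.le_sqrt_of_sq_le ?_)
  rw [Real.norm_eq_abs, sq_abs, sq]
  exact Finset.single_le_sum (f := fun i => t i * t i) (fun i _ => mul_self_nonneg _)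
    (Finset.mem_univ i)

/-- If the conjugate of `Λ` is finite at `x`, then arbitrarily close to `x` there is a
subgradient `y` of a quadratic perturbation of `Λ` at a point `t` such that
`⟨t, y⟩ - Λ t` does not exceed the conjugate at `x`. -/
lemma exists_approximate_subgradient (hc : Continuous Λ) (h0 : Λ 0 = 0) {x : ι → ℝ} {a : ℝ}
    (ha : convexConjugate Λ x ≤ a) {r : ℝ} (hr : 0 < r) :
    ∃ (t y : ι → ℝ) (δ : ℝ), 0 < δ ∧ (∀ i, |y i - x i| < r) ∧ t ⬝ᵥ y - Λ t ≤ a ∧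
      ∀ s, s ⬝ᵥ y - δ * (s ⬝ᵥ s) ≤ Λ (t + s) - Λ t := by
  rw [convexConjugate_le_coe_iff] at ha
  have ha0 : 0 ≤ a := by simpa [h0] using ha 0
  -- At the maximiser `δ⟨t, t⟩ ≤ a`, hence `(2δ t_i)² ≤ 4δa`; this choice of `δ` makes the
  -- displacement `2δt` smaller than `r` in each coordinate.
  set δ := r ^ 2 / (8 * (a + 1)) with hδdef
  have hδ : 0 < δ := by positivity
  have hδa : 4 * δ * a < r ^ 2 := by
    rw [hδdef, mul_div_assoc', div_mul_eq_mul_div, div_lt_iff₀ (by positivity)]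
    nlinarith [sq_pos_of_pos hr]
  set φ : (ι → ℝ) → ℝ := fun t => t ⬝ᵥ x - Λ t - δ * (t ⬝ᵥ t) with hφ
  have hφc : Continuous φ := by
    have : Continuous fun t : ι → ℝ => t ⬝ᵥ x := by unfold dotProduct; fun_prop
    have : Continuous fun t : ι → ℝ => t ⬝ᵥ t := by unfold dotProduct; fun_prop
    fun_prop
  have hφ0 : φ 0 = 0 := by simp [hφ, h0]
  -- Beyond this radius the penalty exceeds `a`, so `φ` falls below `φ 0 = 0` and the maximum over
  -- the ball is global.
  set R := Real.sqrt (a / δ)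
  have hR : 0 ≤ R := Real.sqrt_nonneg _
  obtain ⟨t, -, htmax⟩ := (isCompact_closedBall (0 : ι → ℝ) R).exists_isMaxOn
    ⟨0, by simpa using hR⟩ hφc.continuousOn
  have hφt : 0 ≤ φ t := hφ0 ▸ htmax (by simpa using hR)
  have hmax : ∀ s, φ s ≤ φ t := by
    intro s
    rcases le_or_gt ‖s‖ R with h | h
    · exact htmax (by simpa using h)
    · refine le_trans ?_ hφt
      have h1 : a / δ < ‖s‖ ^ 2 := (Real.sqrt_lt' (hR.trans_lt h)).1 h
      rw [div_lt_iff₀ hδ] at h1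
      have h2 := norm_sq_le_dotProduct_self s
      have h3 := ha s
      simp only [hφ]
      nlinarith
  refine ⟨t, x - (2 * δ) • t, δ, hδ, fun i => ?_, ?_, fun s => ?_⟩
  · have h1 : t i ^ 2 ≤ t ⬝ᵥ t := by
      rw [sq]
      exact Finset.single_le_sum (f := fun i => t i * t i) (fun i _ => mul_self_nonneg _)
        (Finset.mem_univ i)
    have h2 := ha t
    have h4 : δ * (t ⬝ᵥ t) ≤ a := by simp only [hφ] at hφt; linarith
    have h5 : δ * t i ^ 2 ≤ a := (mul_le_mul_of_nonneg_left h1 hδ.le).trans h4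
    have h6 : (2 * δ * t i) ^ 2 < r ^ 2 := by nlinarith
    have h7 := abs_lt_of_sq_lt_sq h6 hr.le
    simpa [abs_mul] using h7
  · have h1 : 0 ≤ t ⬝ᵥ t := (sq_nonneg _).trans (norm_sq_le_dotProduct_self t)
    have h2 := ha t
    rw [dotProduct_sub, dotProduct_smul, smul_eq_mul]
    nlinarith
  · have h1 := hmax (t + s)
    simp only [hφ, add_dotProduct, dotProduct_add] at h1
    rw [dotProduct_sub, dotProduct_smul, smul_eq_mul]
    rw [dotProduct_comm t s] at h1
    linarith

/-- The quadratic minorant bounds `Λ (t - s • u)` from below; the second-difference bound then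
bounds `Λ (t + s • u)` from above, with an error of order `s²` that is beaten by `s * ρ` for small
`s`. -/
lemma exists_smul_sub_lt {t y : ι → ℝ} {δ : ℝ} (hδ : 0 < δ)
    (hy : ∀ s, s ⬝ᵥ y - δ * (s ⬝ᵥ s) ≤ Λ (t + s) - Λ t) {u : ι → ℝ} {C : ℝ}
    (hC : ∀ s : ℝ, 0 < s → s ≤ 1 → Λ (t + s • u) + Λ (t - s • u) ≤ 2 * Λ t + C * s ^ 2)
    {ρ : ℝ} (hρ : 0 < ρ) : ∃ s : ℝ, 0 < s ∧ Λ (t + s • u) - Λ t < s * (u ⬝ᵥ y + ρ) := by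
  have hu : 0 ≤ u ⬝ᵥ u := (sq_nonneg _).trans (norm_sq_le_dotProduct_self u)
  set K := |C| + δ * (u ⬝ᵥ u) + 1
  have hK : 0 < K := by positivity
  refine ⟨min 1 (ρ / (2 * K)), by positivity, ?_⟩
  set s := min 1 (ρ / (2 * K))
  have hs : 0 < s := by positivity
  have hsK : s * K ≤ ρ / 2 := by
    have : s ≤ ρ / (2 * K) := min_le_right _ _
    rw [le_div_iff₀ (by positivity)] at this
    linarith
  have h1 := hC s hs (min_le_left _ _)
  have h2 := hy (-(s • u))
  rw [← sub_eq_add_neg, neg_dotProduct, neg_dotProduct, dotProduct_neg, smul_dotProduct,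
    smul_dotProduct, dotProduct_smul, smul_eq_mul, smul_eq_mul, smul_eq_mul] at h2
  have h3 : C + δ * (u ⬝ᵥ u) ≤ K := by linarith [le_abs_self C]
  nlinarith [mul_le_mul_of_nonneg_left h3 (sq_nonneg s), mul_le_mul_of_nonneg_left hsK hs.le,
    mul_pos hs hρ]

end ConvexConjugate

/-! ### The Gärtner–Ellis theorem. -/

section GartnerEllis

variable {Ω ι : Type*} [MeasurableSpace Ω] [Fintype ι] {P : Measure Ω}
  {X : ℕ → Ω → ι → ℝ} {ε : ℕ → ℝ} {Λ : (ι → ℝ) → ℝ}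

lemma HasCumulantLimit.limsup_le (hX : HasCumulantLimit P X ε Λ) {F : Set (ι → ℝ)}
    (hF : IsClosed F) :
    limsup (fun n => (ε n : EReal) * ENNReal.log (P (X n ⁻¹' F))) atTop ≤
      -(⨅ x ∈ F, convexConjugate Λ x) := by
  rw [EReal.le_neg]
  refine le_of_forall_lt fun b hb => ?_
  obtain ⟨b', hbb', hb'⟩ := EReal.lt_iff_exists_real_btwn.1 hb
  -- The gap `b'' - b'` serves as the slack `δ` in the Chernoff bound.
  obtain ⟨b'', hb'', hb3⟩ := EReal.lt_iff_exists_real_btwn.1 hb'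
  refine hbb'.trans_le (EReal.le_neg.1 ?_)
  rw [EReal.coe_lt_coe_iff] at hb''
  obtain ⟨T, hT⟩ := exists_finset_cover_halfSpaces (Λ := Λ) hF
    (fun x hx => hb3.trans_le (iInf₂_le x hx))
  refine Filter.limsup_le_of_le (h := ?_)
  filter_upwards [hX.scale_pos, hX.measure_biUnion_halfSpace_le T b'' (sub_pos.2 hb'')]
    with n hn hle
  rw [← EReal.coe_neg]
  refine EReal.coe_mul_log_le hn (le_trans (measure_mono ?_) (hle.trans_eq ?_))
  · intro ω hω
    obtain ⟨t, ht, h⟩ := hT _ hω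
    simp only [Set.mem_iUnion]
    exact ⟨t, ht, h.le⟩
  · congr 2; ring

/-- The law tilted at an approximate subgradient gives at least half its mass to a small box around
`y`, which lies in `O`; undoing the tilt costs about `⟨t, y⟩ - Λ t`, at most the conjugate at `x` up
to the chosen slack. -/
lemma HasCumulantLimit.le_liminf (hX : HasCumulantLimit P X ε Λ) (hc : Continuous Λ)
    (h0 : Λ 0 = 0) (hs : ∀ t u, ∃ C : ℝ, ∀ s : ℝ, 0 < s → s ≤ 1 →
      Λ (t + s • u) + Λ (t - s • u) ≤ 2 * Λ t + C * s ^ 2) {O : Set (ι → ℝ)} (hO : IsOpen O) :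
    -(⨅ x ∈ O, convexConjugate Λ x) ≤
      liminf (fun n => (ε n : EReal) * ENNReal.log (P (X n ⁻¹' O))) atTop := by
  classical
  rw [EReal.neg_le]
  refine le_iInf₂ fun x hx => ?_
  rw [EReal.neg_le]
  refine le_of_forall_lt fun b hb => ?_
  obtain ⟨b', hbb', hb'⟩ := EReal.lt_iff_exists_real_btwn.1 hb
  obtain ⟨a, ha', ha⟩ := EReal.lt_iff_exists_real_btwn.1 hb'
  refine hbb'.trans_le ?_
  rw [EReal.coe_lt_coe_iff] at ha'
  have hxa : convexConjugate Λ x ≤ ((-a : ℝ) : EReal) := by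
    rw [EReal.coe_neg]; exact EReal.le_neg.1 ha.le
  obtain ⟨r, hr, hrO⟩ := Metric.isOpen_iff.1 hO x hx
  obtain ⟨t, y, δ, hδ, hyx, hya, hy⟩ :=
    exists_approximate_subgradient hc h0 hxa (half_pos hr)
  set N := ∑ i, |t i|
  have hN : 0 ≤ N := Finset.sum_nonneg fun i _ => abs_nonneg _
  -- The first bound keeps the box inside the `r`-ball around `x`; the second limits the variation
  -- of `⟨t, ·⟩` on the box.
  obtain ⟨ρ, hρ, hρr, hρN⟩ : ∃ ρ > 0, ρ ≤ r / 2 ∧ ρ * N ≤ (a - b') / 2 := by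
    have : 0 < a - b' := sub_pos.2 ha'
    refine ⟨min (r / 2) ((a - b') / 2 / (N + 1)), by positivity, min_le_left _ _, ?_⟩
    calc _ ≤ (a - b') / 2 / (N + 1) * (N + 1) := by
          gcongr
          · exact min_le_right _ _
          · linarith
      _ = _ := by field_simp
  have hdir : ∀ u : ι → ℝ, ∃ s : ℝ, 0 < s ∧ Λ (t + s • u) - Λ t < s * (u ⬝ᵥ y + ρ) := fun u =>
    let ⟨C, hC⟩ := hs t u
    exists_smul_sub_lt hδ hy hC hρ
  choose σ hσ hσ' using hdir
  -- The box has faces normal to `±e_i`; the scalings `σ` make the tilted estimate work and cancel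
  -- from the inequalities defining the box.
  let e : ι ⊕ ι → ι → ℝ := Sum.elim (fun i => Pi.single i 1) (fun i => Pi.single i (-1))
  have hpoly : ∀ w : ι → ℝ, (∀ k, (σ (e k) • e k) ⬝ᵥ w < σ (e k) * (e k ⬝ᵥ y + ρ)) →
      ∀ i, |w i - y i| < ρ := by
    intro w hw i
    have h1 := hw (Sum.inl i)
    have h2 := hw (Sum.inr i)
    rw [smul_dotProduct, smul_eq_mul, mul_lt_mul_iff_right₀ (hσ _)] at h1 h2
    simp only [e, Sum.elim_inl, Sum.elim_inr, single_dotProduct] at h1 h2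
    rw [abs_lt]
    constructor <;> linarith
  have hb : ∀ w : ι → ℝ, (∀ k, (σ (e k) • e k) ⬝ᵥ w < σ (e k) * (e k ⬝ᵥ y + ρ)) →
      t ⬝ᵥ w ≤ t ⬝ᵥ y + ρ * N := by
    intro w hw
    have h1 : t ⬝ᵥ (w - y) ≤ ρ * N := by
      rw [Finset.mul_sum]
      refine Finset.sum_le_sum fun i _ => ?_
      calc t i * (w - y) i ≤ |t i| * |w i - y i| := by
            rw [← abs_mul]; exact le_abs_self _
        _ ≤ ρ * |t i| := by
            rw [mul_comm]
            gcongr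
            exact (hpoly w hw i).le
    rw [dotProduct_sub] at h1
    linarith
  have key := hX.le_measure_polyhedron (fun k => hσ' (e k)) hb (half_pos (sub_pos.2 ha'))
  refine Filter.le_liminf_of_le (h := ?_)
  filter_upwards [hX.scale_pos, key] with n hn hle
  refine EReal.le_coe_mul_log hn (le_trans ?_ (hle.trans (measure_mono ?_)))
  · refine ENNReal.ofReal_le_ofReal (Real.exp_le_exp.2 (div_le_div_of_nonneg_right ?_ hn.le))
    linarith
  · intro ω hω
    refine hrO ((dist_pi_lt_iff hr).2 fun i => ?_)
    rw [Real.dist_eq]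
    have h1 := hpoly _ hω i
    calc |X n ω i - x i| ≤ |X n ω i - y i| + |y i - x i| := abs_sub_le _ _ _
      _ < r := by linarith [hyx i]

/-- The Gärtner–Ellis theorem for a limiting cumulant generating function which is finite
everywhere and smooth in the sense that its symmetric second differences are quadratically small. -/
theorem HasCumulantLimit.satisfiesLDP (hX : HasCumulantLimit P X ε Λ) (hc : Continuous Λ)
    (h0 : Λ 0 = 0) (hs : ∀ t u, ∃ C : ℝ, ∀ s : ℝ, 0 < s → s ≤ 1 →
      Λ (t + s • u) + Λ (t - s • u) ≤ 2 * Λ t + C * s ^ 2) :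
    SatisfiesLDP P X ε (convexConjugate Λ) where
  speed_pos := hX.scale_pos
  speed_tendsto := hX.scale_tendsto
  rate_nonneg := convexConjugate_nonneg h0
  rate_compact := isCompact_convexConjugate_le
  upper_bound _ hF := hX.limsup_le hF
  lower_bound _ hO := hX.le_liminf hc h0 hs hO

lemma SatisfiesLDP.comp_homeomorph {E E' : Type*} [TopologicalSpace E] [TopologicalSpace E']
    (e : E ≃ₜ E') {X : ℕ → Ω → E} {J : E → EReal} {J' : E' → EReal}
    (h : SatisfiesLDP P X ε J) (hJ : ∀ x, J' (e x) = J x) :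
    SatisfiesLDP P (fun n ω => e (X n ω)) ε J' := by
  have hJ' : ∀ y, J' y = J (e.symm y) := fun y => by rw [← hJ, e.apply_symm_apply]
  have hinf : ∀ S : Set E', ⨅ y ∈ S, J' y = ⨅ x ∈ e ⁻¹' S, J x := fun S => by
    rw [← e.surjective.iInf_comp]
    simp [hJ]
  refine ⟨h.speed_pos, h.speed_tendsto, fun y => hJ' y ▸ h.rate_nonneg _, fun a => ?_,
    fun F hF => ?_, fun O hO => ?_⟩
  · simp only [hJ']
    have := e.symm.isCompact_preimage.2 (h.rate_compact a)
    rwa [Set.preimage_ofPred_eq] at this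
  · rw [hinf]
    simpa only [Set.preimage_preimage] using h.upper_bound _ (hF.preimage e.continuous)
  · rw [hinf]
    simpa only [Set.preimage_preimage] using h.lower_bound _ (hO.preimage e.continuous)

end GartnerEllis

/-! ### Exact exponential moments of compound Poisson sums. -/

section CompoundPoisson

lemma lintegral_pow_poissonMeasure_one (m : ℝ≥0) :
    ∫⁻ N : ℕ, (m : ℝ≥0∞) ^ N ∂(poissonMeasure 1) = ENNReal.ofReal (Real.exp (m - 1)) := by
  have hs : HasSum (fun n : ℕ => Real.exp (-1) * ((m : ℝ) ^ n / n.factorial))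
      (Real.exp (m - 1)) := by
    rw [sub_eq_add_neg, add_comm, Real.exp_add, Real.exp_eq_exp_ℝ]
    exact (NormedSpace.expSeries_div_hasSum_exp (m : ℝ)).mul_left _
  rw [lintegral_countable']
  simp only [poissonMeasure_singleton]
  rw [← hs.tsum_eq, ENNReal.ofReal_tsum_of_nonneg (fun n => by positivity) hs.summable]
  refine tsum_congr fun n => ?_
  rw [← ENNReal.ofReal_coe_nnreal, ← ENNReal.ofReal_pow (by positivity),
    ← ENNReal.ofReal_mul (by positivity)]
  congr 1
  simp only [NNReal.coe_one, one_pow]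
  ring

variable {Ω Ω₀ : Type*} [MeasurableSpace Ω] [MeasurableSpace Ω₀]
  {P : Measure Ω} {P₀ : Measure Ω₀} {k d : ℕ}
  {Y₁ : Ω₀ → Fin k → ℝ} {Z₁ : Ω₀ → Fin d → ℝ}
  {Y : ℕ → ℕ → Ω → Fin k → ℝ} {Z : ℕ → ℕ → Ω → Fin d → ℝ} {η : ℕ → Ω → ℕ}

/-- Multiplicative functionals of independent compound Poisson samples. -/
lemma IsPoissonArray.lintegral_prod_range [IsProbabilityMeasure P]
    (hU : IsPoissonArray P P₀ Y₁ Z₁ Y Z η)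
    {G : (Fin k → ℝ) × (Fin d → ℝ) → ℝ≥0∞} (hG : Measurable G) {m : ℝ≥0}
    (hm : ∫⁻ ω, G (Y₁ ω, Z₁ ω) ∂P₀ = m) (n : ℕ) :
    ∫⁻ ω, ∏ i ∈ Finset.range n, ∏ j ∈ Finset.range (η i ω), G (Y i j ω, Z i j ω) ∂P =
      ENNReal.ofReal (Real.exp (n * ((m : ℝ) - 1))) := by
  set A : Ω → ℕ × ℕ → (Fin k → ℝ) × (Fin d → ℝ) := fun ω q => (Y q.1 q.2 ω, Z q.1 q.2 ω)
  set H : Ω → ℕ → ℕ := fun ω i => η i ω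
  have hA : Measurable A := measurable_pi_lambda _ fun q =>
    (hU.measurable_Y q.1 q.2).prodMk (hU.measurable_Z q.1 q.2)
  have hH : Measurable H := measurable_pi_lambda _ hU.measurable_η
  set Φ : (ℕ → ℕ) × (ℕ × ℕ → (Fin k → ℝ) × (Fin d → ℝ)) → ℝ≥0∞ := fun x =>
    ∏ i ∈ Finset.range n, ∏ j ∈ Finset.range (x.1 i), G (x.2 (i, j))
  have hΦ : Measurable Φ := by
    refine Finset.measurable_fun_prod _ fun i _ => ?_
    have h1 : Measurable fun y : ℕ × (ℕ × ℕ → (Fin k → ℝ) × (Fin d → ℝ)) =>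
        ∏ j ∈ Finset.range y.1, G (y.2 (i, j)) :=
      measurable_from_prod_countable_right fun N =>
        Finset.measurable_fun_prod (Finset.range N) fun j _ => hG.comp (measurable_pi_apply (i, j))
    have h2 : Measurable fun x : (ℕ → ℕ) × (ℕ × ℕ → (Fin k → ℝ) × (Fin d → ℝ)) => (x.1 i, x.2) := by
      fun_prop
    exact h1.comp h2
  -- By Fubini the counts can be frozen while integrating over the array; each sample point then
  -- contributes a factor `m`, and the Poisson generating function handles the counts.
  have hind : P.map (fun ω => (H ω, A ω)) = (P.map H).prod (P.map A) :=
    (indepFun_iff_map_prod_eq_prod_map_map hH.aemeasurable hA.aemeasurable).1 hU.indep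
  have hone : ∀ q : ℕ × ℕ, ∫⁻ ω, G (A ω q) ∂P = m := fun q => by
    rw [← hm]
    exact ((hU.identDistrib q.1 q.2).comp hG).lintegral_eq
  have hinner : ∀ x : ℕ → ℕ, ∫⁻ a, Φ (x, a) ∂(P.map A) = ∏ i ∈ Finset.range n, (m : ℝ≥0∞) ^ x i := by
    intro x
    rw [lintegral_map (f := fun a => Φ (x, a)) (hΦ.comp measurable_prodMk_left) hA]
    have h1 : ∀ ω, Φ (x, A ω) = ∏ q ∈ (Finset.range n).sigma (fun i => Finset.range (x i)),
        G (A ω (q.1, q.2)) := fun ω => by rw [Finset.prod_sigma]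
    have hinj : Function.Injective fun q : (_ : ℕ) × ℕ => (q.1, q.2) := fun a b h => by
      cases a; cases b; simp_all
    have hi : iIndepFun (fun (q : (_ : ℕ) × ℕ) ω => G (A ω (q.1, q.2))) P :=
      (hU.iIndep_array.precomp hinj).comp (fun _ => G) fun _ => hG
    simp only [h1]
    rw [lintegral_prod_eq_prod_lintegral_of_indepFun _ _ hi
      (fun q => hG.comp ((measurable_pi_apply _).comp hA))]
    simp [hone, Finset.prod_pow_eq_pow_sum]
  have hmeas : ∀ i, Measurable fun ω => (m : ℝ≥0∞) ^ η i ω := fun i =>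
    (measurable_of_countable fun N : ℕ => (m : ℝ≥0∞) ^ N).comp (hU.measurable_η i)
  calc ∫⁻ ω, Φ (H ω, A ω) ∂P = ∫⁻ x, Φ x ∂(P.map H).prod (P.map A) := by
        rw [← hind, lintegral_map hΦ (hH.prodMk hA)]
    _ = ∫⁻ x, ∏ i ∈ Finset.range n, (m : ℝ≥0∞) ^ x i ∂(P.map H) := by
        have := Measure.isProbabilityMeasure_map (μ := P) hA.aemeasurable
        rw [MeasureTheory.lintegral_prod _ hΦ.aemeasurable]
        simp only [hinner]
    _ = ∫⁻ ω, ∏ i ∈ Finset.range n, (m : ℝ≥0∞) ^ η i ω ∂P := by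
        rw [lintegral_map _ hH]
        exact Finset.measurable_fun_prod _ fun i _ =>
          (measurable_of_countable fun N : ℕ => (m : ℝ≥0∞) ^ N).comp (measurable_pi_apply i)
    _ = ∏ i ∈ Finset.range n, ∫⁻ ω, (m : ℝ≥0∞) ^ η i ω ∂P :=
        lintegral_prod_eq_prod_lintegral_of_indepFun _ _
          (hU.iIndep_η.comp (fun _ N => (m : ℝ≥0∞) ^ N) fun _ => measurable_of_countable _) hmeas
    _ = ∏ i ∈ Finset.range n, ENNReal.ofReal (Real.exp (m - 1)) := by
        refine Finset.prod_congr rfl fun i _ => ?_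
        rw [← lintegral_pow_poissonMeasure_one, ← hU.law_η i,
          lintegral_map (measurable_of_countable _) (hU.measurable_η i)]
    _ = ENNReal.ofReal (Real.exp (n * ((m : ℝ) - 1))) := by
        rw [Finset.prod_const, Finset.card_range, ← ENNReal.ofReal_pow (Real.exp_nonneg _),
          ← Real.exp_nat_mul]

end CompoundPoisson

/-! ### Regularity inherited by limits of Laplace transforms. -/

section LimitOfExponentialMoments

/-- The quadratic factor `w²` is dominated by an exponential, so that after integration the right
side involves only values of the Laplace transform, at `t` and `t ± 2u`. -/
lemma exp_add_exp_neg_le {σ w : ℝ} (hσ : 0 < σ) (hσ1 : σ ≤ 1) :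
    Real.exp (σ * w) + Real.exp (-(σ * w)) ≤
      2 + 2 * σ ^ 2 * (Real.exp (2 * w) + Real.exp (-(2 * w))) := by
  wlog hw : 0 ≤ w generalizing w
  · have := this (w := -w) (by linarith)
    simp only [mul_neg, neg_neg] at this
    linarith
  have hx : 0 ≤ σ * w := by positivity
  set x := σ * w with hxdef
  have hxw : x ≤ w := by nlinarith
  have h1 : Real.exp x + Real.exp (-x) - 2 = Real.exp x * (1 - Real.exp (-x)) ^ 2 := by
    have : Real.exp x * Real.exp (-x) = 1 := by rw [← Real.exp_add]; simp
    linear_combination (2 - Real.exp (-x)) * this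
  have h2 : (1 - Real.exp (-x)) ^ 2 ≤ x ^ 2 := by
    have h3 := Real.add_one_le_exp (-x)
    have h4 : Real.exp (-x) ≤ 1 := Real.exp_le_one_iff.2 (by linarith)
    exact pow_le_pow_left₀ (by linarith) (by linarith) 2
  have h5 : w ^ 2 ≤ 2 * Real.exp w := by
    have := Real.quadratic_le_exp_of_nonneg hw
    linarith
  have h6 : Real.exp x * (1 - Real.exp (-x)) ^ 2 ≤ 2 * σ ^ 2 * Real.exp (2 * w) := by
    calc Real.exp x * (1 - Real.exp (-x)) ^ 2 ≤ Real.exp w * x ^ 2 := by gcongr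
      _ = Real.exp w * (σ ^ 2 * w ^ 2) := by rw [hxdef]; ring
      _ ≤ Real.exp w * (σ ^ 2 * (2 * Real.exp w)) := by gcongr
      _ = 2 * σ ^ 2 * Real.exp (2 * w) := by rw [two_mul w, Real.exp_add]; ring
  have h7 : 0 ≤ 2 * σ ^ 2 * Real.exp (-(2 * w)) := by positivity
  linarith

variable {Ω α : Type*} [MeasurableSpace Ω] {k : ℕ} {Y : Ω → Fin k → ℝ} {l : Filter α} [l.NeBot]
  {μ : α → Measure Ω} {L : (Fin k → ℝ) → ℝ≥0}

lemma measurable_exp_dotProduct (hY : Measurable Y) (t : Fin k → ℝ) :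
    Measurable fun ω => ENNReal.ofReal (Real.exp (t ⬝ᵥ Y ω)) := by
  have := fun i => (measurable_pi_iff.1 hY) i
  unfold dotProduct
  fun_prop

/-- Convexity of `exp` survives integration and the limit; since `L` is finite everywhere, this
yields its continuity. -/
lemma convexOn_of_tendsto_lintegral_exp (hY : Measurable Y)
    (hL : ∀ t, Tendsto (fun a => ∫⁻ ω, ENNReal.ofReal (Real.exp (t ⬝ᵥ Y ω)) ∂(μ a)) l
      (𝓝 (L t : ℝ≥0∞))) : ConvexOn ℝ Set.univ fun t => (L t : ℝ) := by
  refine ⟨convex_univ, fun t _ s _ a b ha hb hab => ?_⟩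
  have h1 : (L (a • t + b • s) : ℝ≥0∞) ≤ ENNReal.ofReal a * L t + ENNReal.ofReal b * L s := by
    refine le_of_tendsto_of_tendsto' (hL _)
      ((ENNReal.Tendsto.const_mul (hL t) (Or.inr ENNReal.ofReal_ne_top)).add
        (ENNReal.Tendsto.const_mul (hL s) (Or.inr ENNReal.ofReal_ne_top))) fun c => ?_
    rw [← lintegral_const_mul _ (measurable_exp_dotProduct hY t),
      ← lintegral_const_mul _ (measurable_exp_dotProduct hY s),
      ← lintegral_add_left ((measurable_exp_dotProduct hY t).const_mul _)]
    refine lintegral_mono fun ω => ?_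
    rw [← ENNReal.ofReal_mul ha, ← ENNReal.ofReal_mul hb,
      ← ENNReal.ofReal_add (by positivity) (by positivity)]
    refine ENNReal.ofReal_le_ofReal ?_
    rw [add_dotProduct, smul_dotProduct, smul_dotProduct]
    exact convexOn_exp.2 (Set.mem_univ _) (Set.mem_univ _) ha hb hab
  rw [← ENNReal.ofReal_coe_nnreal, ← ENNReal.ofReal_coe_nnreal, ← ENNReal.ofReal_coe_nnreal,
    ← ENNReal.ofReal_mul ha, ← ENNReal.ofReal_mul hb,
    ← ENNReal.ofReal_add (by positivity) (by positivity),
    ENNReal.ofReal_le_ofReal_iff (by positivity)] at h1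
  exact h1

lemma secondDifference_le_of_tendsto_lintegral_exp (hY : Measurable Y)
    (hL : ∀ t, Tendsto (fun a => ∫⁻ ω, ENNReal.ofReal (Real.exp (t ⬝ᵥ Y ω)) ∂(μ a)) l
      (𝓝 (L t : ℝ≥0∞))) (t u : Fin k → ℝ) {σ : ℝ} (hσ : 0 < σ) (hσ1 : σ ≤ 1) :
    (L (t + σ • u) : ℝ) + L (t - σ • u) ≤
      2 * L t + 2 * σ ^ 2 * (L (t + (2 : ℝ) • u) + L (t - (2 : ℝ) • u)) := by
  have h1 : (L (t + σ • u) : ℝ≥0∞) + L (t - σ • u) ≤ ENNReal.ofReal 2 * L t +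
      ENNReal.ofReal (2 * σ ^ 2) * (L (t + (2 : ℝ) • u) + L (t - (2 : ℝ) • u)) := by
    refine le_of_tendsto_of_tendsto' ((hL _).add (hL _))
      ((ENNReal.Tendsto.const_mul (hL t) (Or.inr ENNReal.ofReal_ne_top)).add
        (ENNReal.Tendsto.const_mul ((hL _).add (hL _)) (Or.inr ENNReal.ofReal_ne_top))) fun c => ?_
    have hm := measurable_exp_dotProduct hY
    rw [← lintegral_add_left (hm _), ← lintegral_add_left (hm _), ← lintegral_const_mul _ (hm t),
      ← lintegral_const_mul _ ((hm _).fun_add (hm _)), ← lintegral_add_left ((hm t).const_mul _)]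
    refine lintegral_mono fun ω => ?_
    rw [← ENNReal.ofReal_add (by positivity) (by positivity),
      ← ENNReal.ofReal_add (by positivity) (by positivity), ← ENNReal.ofReal_mul (by positivity),
      ← ENNReal.ofReal_mul (by positivity), ← ENNReal.ofReal_add (by positivity) (by positivity)]
    refine ENNReal.ofReal_le_ofReal ?_
    simp only [add_dotProduct, neg_dotProduct, smul_dotProduct, smul_eq_mul, sub_eq_add_neg,
      Real.exp_add]
    have := mul_le_mul_of_nonneg_left (exp_add_exp_neg_le (w := u ⬝ᵥ Y ω) hσ hσ1)
      (Real.exp_nonneg (t ⬝ᵥ Y ω))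
    linarith
  simp only [← ENNReal.ofReal_coe_nnreal] at h1
  rw [← ENNReal.ofReal_add (by positivity) (by positivity),
    ← ENNReal.ofReal_add (by positivity) (by positivity), ← ENNReal.ofReal_mul (by positivity),
    ← ENNReal.ofReal_mul (by positivity), ← ENNReal.ofReal_add (by positivity) (by positivity),
    ENNReal.ofReal_le_ofReal_iff (by positivity)] at h1
  exact h1

lemma eq_one_of_tendsto_lintegral_exp
    (hL : ∀ t, Tendsto (fun a => ∫⁻ ω, ENNReal.ofReal (Real.exp (t ⬝ᵥ Y ω)) ∂(μ a)) l
      (𝓝 (L t : ℝ≥0∞))) (hμ : ∀ᶠ a in l, IsProbabilityMeasure (μ a)) : L 0 = 1 := by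
  have h1 : Tendsto (fun a => ∫⁻ ω, ENNReal.ofReal (Real.exp ((0 : Fin k → ℝ) ⬝ᵥ Y ω)) ∂(μ a)) l
      (𝓝 1) := by
    refine tendsto_const_nhds.congr' ?_
    filter_upwards [hμ] with a ha
    simp
  exact_mod_cast tendsto_nhds_unique (hL 0) h1

end LimitOfExponentialMoments

/-! ### Geometry of the dyadic cells. -/

section Cells

variable {d : ℕ}

lemma sub_mem_shrink_zero_iff {z w : Fin d → ℝ} {h : ℝ} {C : Set (Fin d → ℝ)} :
    w - z ∈ shrink 0 h C ↔ w ∈ shrink z h C := by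
  simp only [shrink, Set.mem_image, zero_add, eq_sub_iff_add_eq']

lemma measurableSet_shrink {z : Fin d → ℝ} {h : ℝ} {C : Set (Fin d → ℝ)} (hC : MeasurableSet C) :
    MeasurableSet (shrink z h C) := by
  -- No sign is imposed on `h`; if the scaling factor vanishes, the image is at most a point.
  rcases eq_or_ne (h ^ (1 / (d : ℝ))) 0 with h0 | h0
  · refine Set.Subsingleton.measurableSet ?_
    rintro _ ⟨a, -, rfl⟩ _ ⟨b, -, rfl⟩
    simp only [h0, zero_smul]
  · rw [shrink, Set.image_eq_preimage_of_inverse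
      (g := fun x => (h ^ (1 / (d : ℝ)))⁻¹ • (x - z))]
    · exact (by fun_prop : Measurable fun x : Fin d → ℝ => (h ^ (1 / (d : ℝ)))⁻¹ • (x - z)) hC
    · intro c
      simp only [add_sub_cancel_left, inv_smul_smul₀ h0]
    · intro x
      simp only [smul_inv_smul₀ h0, add_sub_cancel]

lemma disjoint_shrink {z : Fin d → ℝ} {h : ℝ} (hh : 0 < h) {C C' : Set (Fin d → ℝ)}
    (hC : Disjoint C C') : Disjoint (shrink z h C) (shrink z h C') :=
  (Set.disjoint_image_iff fun _ _ hab =>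
    smul_right_injective _ (Real.rpow_pos_of_pos hh _).ne' (add_left_cancel hab)).2 hC

variable {p : ℕ}

lemma dyadicCell_eq_pi (j : Fin d → Fin (2 ^ p)) : dyadicCell p j = Set.pi Set.univ
    fun l => Set.Ico (((j l : ℕ) : ℝ) / 2 ^ p) ((((j l : ℕ) : ℝ) + 1) / 2 ^ p) := by
  ext s
  simp [dyadicCell]

lemma measurableSet_dyadicCell (j : Fin d → Fin (2 ^ p)) : MeasurableSet (dyadicCell p j) := by
  rw [dyadicCell_eq_pi]
  exact MeasurableSet.univ_pi fun l => measurableSet_Ico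

lemma volume_real_dyadicCell_pos (j : Fin d → Fin (2 ^ p)) :
    0 < volume.real (dyadicCell p j) := by
  rw [dyadicCell_eq_pi, Measure.real, Real.volume_pi_Ico_toReal fun l => by gcongr; simp]
  refine Finset.prod_pos fun l _ => ?_
  rw [← sub_div]
  simp

/-- The union of `d` cubes may repeat the same cube `d` times, which is nonempty as `1 ≤ d`. -/
lemma dyadicCell_mem_cubeUnions (hd : 1 ≤ d) (j : Fin d → Fin (2 ^ p)) :
    dyadicCell p j ∈ cubeUnions d := by
  have : Nonempty (Fin d) := ⟨⟨0, hd⟩⟩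
  refine ⟨⟨fun _ l => ((j l : ℕ) : ℝ) / 2 ^ p, fun _ => 1 / 2 ^ p, fun _ => by positivity, ?_⟩,
    ENNReal.toReal_pos_iff.1 (volume_real_dyadicCell_pos j) |>.1⟩
  rw [Set.iUnion_const]
  simp only [hypercube, dyadicCell, add_div]

lemma pairwise_disjoint_dyadicCell :
    Pairwise (Function.onFun Disjoint (dyadicCell p : (Fin d → Fin (2 ^ p)) → _)) := by
  intro i j hij
  refine Set.disjoint_left.2 fun s hi hj => hij (funext fun l => Fin.ext ?_)
  have h2 : (0 : ℝ) < 2 ^ p := by positivity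
  have h1 := (div_le_iff₀ h2).1 (hi l).1
  have h3 := (lt_div_iff₀ h2).1 (hi l).2
  have h4 := (div_le_iff₀ h2).1 (hj l).1
  have h5 := (lt_div_iff₀ h2).1 (hj l).2
  have h6 : ((i l : ℕ) : ℝ) < (j l : ℕ) + 1 := by linarith
  have h7 : ((j l : ℕ) : ℝ) < (i l : ℕ) + 1 := by linarith
  norm_cast at h6 h7
  omega

end Cells

/-! ### Conjugates of separable functions. -/

section SeparableConjugate

lemma EReal.coe_finset_sum {κ : Type*} (S : Finset κ) (f : κ → ℝ) :
    ((∑ j ∈ S, f j : ℝ) : EReal) = ∑ j ∈ S, (f j : EReal) := by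
  induction S using Finset.cons_induction with
  | empty => simp
  | cons a S ha ih => rw [Finset.sum_cons, Finset.sum_cons, EReal.coe_add, ih]

/-- The coordinates of `t` are free of each other, so near-optimal choices can be combined one
coordinate at a time. -/
lemma EReal.iSup_coe_sum {κ T : Type*} [Fintype κ] [Nonempty T] (g : κ → T → ℝ) :
    ⨆ t : κ → T, ((∑ j, g j (t j) : ℝ) : EReal) = ∑ j, ⨆ s, (g j s : EReal) := by
  classical
  refine le_antisymm (iSup_le fun t => ?_) ?_
  · rw [EReal.coe_finset_sum]
    exact Finset.sum_le_sum fun j _ => le_iSup (fun s => (g j s : EReal)) (t j)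
  · suffices h : ∀ S : Finset κ, ∑ j ∈ S, ⨆ s, (g j s : EReal) ≤
        ⨆ t : κ → T, ((∑ j ∈ S, g j (t j) : ℝ) : EReal) from h _
    intro S
    induction S using Finset.cons_induction with
    | empty => simp
    | cons a S ha ih =>
      rw [Finset.sum_cons]
      refine (add_le_add_right ih _).trans (EReal.add_le_of_forall_lt fun x hx y hy => ?_)
      obtain ⟨s, hs⟩ := lt_iSup_iff.1 hx
      obtain ⟨t, ht⟩ := lt_iSup_iff.1 hy
      refine (add_le_add hs.le ht.le).trans
        (le_iSup_of_le (Function.update t a s) (le_of_eq ?_))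
      rw [Finset.sum_cons, EReal.coe_add, Function.update_self]
      congr 2
      refine Finset.sum_congr rfl fun j hj => ?_
      rw [Function.update_of_ne (by rintro rfl; exact ha hj)]

lemma coe_mul_legendre_inv_smul {k : ℕ} (L : (Fin k → ℝ) → ℝ≥0) {c : ℝ} (hc : 0 < c)
    (x : Fin k → ℝ) : (c : EReal) * legendre L (c⁻¹ • x) =
      ⨆ s : Fin k → ℝ, ((s ⬝ᵥ x - c * ((L s : ℝ) - 1) : ℝ) : EReal) := by
  have hterm : ∀ s : Fin k → ℝ, (c : EReal) * ((s ⬝ᵥ (c⁻¹ • x) - ((L s : ℝ) - 1) : ℝ) : EReal) =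
      ((s ⬝ᵥ x - c * ((L s : ℝ) - 1) : ℝ) : EReal) := fun s => by
    rw [← EReal.coe_mul, dotProduct_smul, smul_eq_mul]
    congr 1
    field_simp
  have hc' : (0 : EReal) < c := by exact_mod_cast hc
  refine le_antisymm ?_ (iSup_le fun s => ?_)
  · rw [mul_comm, ← EReal.le_div_iff_mul_le hc' (EReal.coe_ne_top c)]
    refine iSup_le fun s => ?_
    rw [EReal.le_div_iff_mul_le hc' (EReal.coe_ne_top c), mul_comm, hterm]
    exact le_iSup (fun s : Fin k → ℝ => ((s ⬝ᵥ x - c * ((L s : ℝ) - 1) : ℝ) : EReal)) s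
  · rw [← hterm]
    exact mul_le_mul_of_nonneg_left (le_iSup (fun t : Fin k → ℝ =>
      ((t ⬝ᵥ (c⁻¹ • x) - ((L t : ℝ) - 1) : ℝ) : EReal)) s) hc'.le

/-- The limiting cumulant generating function of the vector of increments over the cells. -/
noncomputable def cellCumulant {k : ℕ} (d p : ℕ) (L : (Fin k → ℝ) → ℝ≥0)
    (t : (Fin d → Fin (2 ^ p)) × Fin k → ℝ) : ℝ :=
  ∑ j, volume.real (dyadicCell p j) * ((L fun l => t (j, l) : ℝ) - 1)

lemma convexConjugate_cellCumulant {k : ℕ} (d p : ℕ) (L : (Fin k → ℝ) → ℝ≥0)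
    (x : (Fin d → Fin (2 ^ p)) × Fin k → ℝ) :
    cellRate d p L (Function.curry x) = convexConjugate (cellCumulant d p L) x := by
  simp only [cellRate, coe_mul_legendre_inv_smul L (volume_real_dyadicCell_pos _)]
  rw [← EReal.iSup_coe_sum, convexConjugate,
    ← (Equiv.curry (Fin d → Fin (2 ^ p)) (Fin k) ℝ).surjective.iSup_comp]
  refine iSup_congr fun t => ?_
  rw [Finset.sum_sub_distrib]
  simp only [cellCumulant, dotProduct, Fintype.sum_prod_type]
  rfl

end SeparableConjugate

/-! ### Exponential moments over disjoint events. -/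

section DisjointEvents

variable {Ω : Type*} [MeasurableSpace Ω]

lemma setLIntegral_eq_mul_lintegral_cond {μ : Measure Ω} [IsFiniteMeasure μ] {B : Set Ω}
    (hB : μ B ≠ 0) (f : Ω → ℝ≥0∞) : ∫⁻ ω in B, f ω ∂μ = μ B * ∫⁻ ω, f ω ∂(cond μ B) := by
  rw [ProbabilityTheory.cond, lintegral_smul_measure, smul_eq_mul, ← mul_assoc,
    ENNReal.mul_inv_cancel hB (measure_ne_top μ B), one_mul]

/-- The moment generating function of a variable that equals `f j` on the event `B j`, for
disjoint events `B j`, and vanishes off their union. -/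
lemma lintegral_exp_sum_indicator {κ : Type*} [Fintype κ] {μ : Measure Ω} [IsProbabilityMeasure μ]
    {B : κ → Set Ω} (hB : ∀ j, MeasurableSet (B j)) (hd : Pairwise (Function.onFun Disjoint B))
    (hB0 : ∀ j, μ (B j) ≠ 0) {f : κ → Ω → ℝ}
    (hf : ∀ j, ∫⁻ ω, ENNReal.ofReal (Real.exp (f j ω)) ∂(cond μ (B j)) ≠ ∞) :
    ∃ m : ℝ≥0, ∫⁻ ω, ENNReal.ofReal (Real.exp (∑ j, (B j).indicator (f j) ω)) ∂μ = m ∧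
      (m : ℝ) - 1 = ∑ j, μ.real (B j) *
        ((∫⁻ ω, ENNReal.ofReal (Real.exp (f j ω)) ∂(cond μ (B j))).toReal - 1) := by
  set c := fun j => ∫⁻ ω, ENNReal.ofReal (Real.exp (f j ω)) ∂(cond μ (B j))
  have hU : MeasurableSet (⋃ j, B j) := MeasurableSet.iUnion hB
  -- Off the union the exponent is zero and contributes `1 - ∑ μ (B j)`; this produces the `-1` in
  -- each summand.
  have hI : ∫⁻ ω, ENNReal.ofReal (Real.exp (∑ j, (B j).indicator (f j) ω)) ∂μ =
      ∑ j, μ (B j) * c j + μ (⋃ j, B j)ᶜ := by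
    rw [← lintegral_add_compl _ hU]
    congr 1
    · rw [lintegral_iUnion hB hd, tsum_fintype]
      refine Finset.sum_congr rfl fun j _ => ?_
      rw [← setLIntegral_eq_mul_lintegral_cond (hB0 j)]
      refine setLIntegral_congr_fun (hB j) fun ω hω => ?_
      rw [Finset.sum_eq_single j, Set.indicator_of_mem hω]
      · intro i _ hij
        exact Set.indicator_of_notMem (fun hi => Set.disjoint_left.1 (hd hij) hi hω) _
      · simp
    · rw [← setLIntegral_one]
      refine setLIntegral_congr_fun hU.compl fun ω hω => ?_
      rw [Finset.sum_eq_zero, Real.exp_zero, ENNReal.ofReal_one]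
      intro j _
      exact Set.indicator_of_notMem (fun hj => hω (Set.mem_iUnion.2 ⟨j, hj⟩)) _
  have hne : ∀ j, μ (B j) * c j ≠ ∞ := fun j => ENNReal.mul_ne_top (measure_ne_top _ _) (hf j)
  have hsum : ∑ j, μ (B j) * c j ≠ ∞ := ENNReal.sum_ne_top.2 fun j _ => hne j
  have hfin : ∑ j, μ (B j) * c j + μ (⋃ j, B j)ᶜ ≠ ∞ :=
    ENNReal.add_ne_top.2 ⟨hsum, measure_ne_top _ _⟩
  refine ⟨(∑ j, μ (B j) * c j + μ (⋃ j, B j)ᶜ).toNNReal, ?_, ?_⟩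
  · rw [ENNReal.coe_toNNReal hfin, hI]
  · have hcompl : μ.real (⋃ j, B j)ᶜ = 1 - ∑ j, μ.real (B j) := by
      rw [probReal_compl_eq_one_sub hU, measureReal_iUnion_fintype hd hB]
    have hr : (μ (⋃ j, B j)ᶜ).toReal = 1 - ∑ j, μ.real (B j) := hcompl
    rw [ENNReal.coe_toNNReal_eq_toReal, ENNReal.toReal_add hsum (measure_ne_top _ _), hr,
      ENNReal.toReal_sum fun j _ => hne j]
    simp only [ENNReal.toReal_mul, mul_sub, mul_one, Finset.sum_sub_distrib, Measure.real, c]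
    ring

end DisjointEvents

/-! ### Cumulants of the Poissonised increments. -/

section PoissonIncrements

variable {Ω₀ Ω : Type*} [MeasurableSpace Ω₀] [MeasurableSpace Ω] {P₀ : Measure Ω₀}
  {P : Measure Ω} {k d : ℕ} {Y₁ : Ω₀ → Fin k → ℝ} {Z₁ : Ω₀ → Fin d → ℝ}
  {z : Fin d → ℝ} {fz : ℝ} {LY : (Fin k → ℝ) → ℝ≥0} {LabsY : ℝ → ℝ≥0}
  {Y : ℕ → ℕ → Ω → Fin k → ℝ} {Z : ℕ → ℕ → Ω → Fin d → ℝ} {η : ℕ → Ω → ℕ}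

lemma IsPoissonArray.measurable_poissonIncrement (hU : IsPoissonArray P P₀ Y₁ Z₁ Y Z η)
    (n : ℕ) (h : ℝ) {C : Set (Fin d → ℝ)} (hC : MeasurableSet C) :
    Measurable fun ω => poissonIncrement z fz Y Z η n h C ω := by
  suffices hsum : ∀ i, Measurable fun ω =>
      compoundIncrement z (η i ω) (fun j => Y i j ω) (fun j => Z i j ω) (shrink 0 h C) from
    (Finset.measurable_fun_sum (Finset.range n) fun i _ => hsum i).const_smul
      ((n : ℝ) * h * fz)⁻¹
  intro i
  have h1 : Measurable fun x : ℕ × Ω => ∑ j ∈ Finset.range x.1,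
      (shrink 0 h C).indicator (fun _ => Y i j x.2) (Z i j x.2 - z) := by
    refine measurable_from_prod_countable_right fun N =>
      Finset.measurable_fun_sum (Finset.range N) fun j _ => ?_
    have hS : MeasurableSet ((fun ω => Z i j ω - z) ⁻¹' shrink 0 h C) :=
      ((hU.measurable_Z i j).sub_const z) (measurableSet_shrink hC)
    exact (hU.measurable_Y i j).indicator hS
  exact h1.comp ((hU.measurable_η i).prodMk measurable_id)

lemma HL1.eventually_ne_zero (h1 : HL1 P₀ Z₁ z fz) {C : Set (Fin d → ℝ)}
    (hC : C ∈ cubeUnions d) (hpos : 0 < volume.real C) :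
    ∀ᶠ h in 𝓝[>] (0 : ℝ), P₀ (Z₁ ⁻¹' shrink z h C) ≠ 0 := by
  filter_upwards [(h1.2 C hC).eventually_const_lt (mul_pos hpos h1.1)] with h hh h0
  rw [Measure.real, h0] at hh
  simp at hh

/-- Dividing by the scale cancels the normalisation, leaving an additive functional of the sample
points whose exponential is multiplicative. -/
lemma poissonIncrement_pairing {Ω' : Type*} {Y : ℕ → ℕ → Ω' → Fin k → ℝ}
    {Z : ℕ → ℕ → Ω' → Fin d → ℝ} {η : ℕ → Ω' → ℕ} {p : ℕ} {n : ℕ} {h : ℝ} (hne : (n : ℝ) * h * fz ≠ 0)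
    (t : (Fin d → Fin (2 ^ p)) × Fin k → ℝ) (ω : Ω') :
    t ⬝ᵥ (fun q => poissonIncrement z fz Y Z η n h (dyadicCell p q.1) ω q.2) /
        ((n : ℝ) * h * fz)⁻¹ =
      ∑ i ∈ Finset.range n, ∑ m ∈ Finset.range (η i ω), ∑ j : Fin d → Fin (2 ^ p),
        (shrink z h (dyadicCell p j)).indicator
          (fun _ => (fun l => t (j, l)) ⬝ᵥ Y i m ω) (Z i m ω) := by
  have hterm : ∀ i m (j : Fin d → Fin (2 ^ p)), (shrink z h (dyadicCell p j)).indicator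
      (fun _ => (fun l => t (j, l)) ⬝ᵥ Y i m ω) (Z i m ω) = (fun l => t (j, l)) ⬝ᵥ
        (shrink 0 h (dyadicCell p j)).indicator (fun _ => Y i m ω) (Z i m ω - z) := by
    intro i m j
    by_cases hmem : Z i m ω ∈ shrink z h (dyadicCell p j)
    · rw [Set.indicator_of_mem hmem, Set.indicator_of_mem (sub_mem_shrink_zero_iff.2 hmem)]
    · rw [Set.indicator_of_notMem hmem,
        Set.indicator_of_notMem (mt sub_mem_shrink_zero_iff.1 hmem), dotProduct_zero]
  have hsplit : t ⬝ᵥ (fun q => poissonIncrement z fz Y Z η n h (dyadicCell p q.1) ω q.2) =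
      ∑ j : Fin d → Fin (2 ^ p),
        (fun l => t (j, l)) ⬝ᵥ poissonIncrement z fz Y Z η n h (dyadicCell p j) ω := by
    simp only [dotProduct, Fintype.sum_prod_type]
  rw [hsplit, Finset.sum_div]
  simp only [hterm, poissonIncrement, compoundIncrement, dotProduct_smul, smul_eq_mul,
    mul_div_cancel_left₀ _ (inv_ne_zero hne), dotProduct_sum]
  rw [Finset.sum_comm]
  refine Finset.sum_congr rfl fun i _ => Finset.sum_comm

lemma hasCumulantLimit_poissonIncrement [IsProbabilityMeasure P₀] [IsProbabilityMeasure P]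
    (hd : 1 ≤ d) (hZ₁ : Measurable Z₁)
    (h1 : HL1 P₀ Z₁ z fz) (h2 : HL2 P₀ Y₁ Z₁ z LY LabsY)
    (hU : IsPoissonArray P P₀ Y₁ Z₁ Y Z η) {h : ℕ → ℝ} (h_zero : Tendsto h atTop (𝓝 0))
    (h_infty : Tendsto (fun n : ℕ => (n : ℝ) * h n) atTop atTop) (p : ℕ) :
    HasCumulantLimit P
      (fun n ω (q : (Fin d → Fin (2 ^ p)) × Fin k) =>
        poissonIncrement z fz Y Z η n (h n) (dyadicCell p q.1) ω q.2)
      (fun n : ℕ => ((n : ℝ) * h n * fz)⁻¹) (cellCumulant d p LY) := by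
  have hf := h1.1
  have hspeed : Tendsto (fun n : ℕ => (n : ℝ) * h n * fz) atTop atTop :=
    h_infty.atTop_mul_const hf
  have hpos : ∀ᶠ n : ℕ in atTop, 0 < h n := by
    filter_upwards [h_infty.eventually_gt_atTop 0] with n hn
    exact pos_of_mul_pos_right hn n.cast_nonneg
  have hh : Tendsto h atTop (𝓝[>] 0) := tendsto_nhdsWithin_iff.2 ⟨h_zero, hpos⟩
  refine ⟨fun n => measurable_pi_lambda _ fun q => (measurable_pi_apply q.2).comp
      (hU.measurable_poissonIncrement n (h n) (measurableSet_dyadicCell q.1)), ?_,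
    hspeed.inv_tendsto_atTop, fun t => ?_⟩
  · filter_upwards [hspeed.eventually_gt_atTop 0] with n hn using inv_pos.2 hn
  let c := fun n (j : Fin d → Fin (2 ^ p)) =>
    ∫⁻ ω, ENNReal.ofReal (Real.exp ((fun l => t (j, l)) ⬝ᵥ Y₁ ω))
      ∂(cond P₀ (Z₁ ⁻¹' shrink z (h n) (dyadicCell p j)))
  have hc : ∀ j, Tendsto (fun n => c n j) atTop (𝓝 (LY fun l => t (j, l) : ℝ≥0∞)) := fun j =>
    ((h2 _ (dyadicCell_mem_cubeUnions hd j)).1 _).comp hh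
  -- This is the exact scaled cumulant `n(m - 1) / (n h f)` once the conditional moments are finite
  -- and the cells are charged.
  refine ⟨fun n => ∑ j, (h n)⁻¹ * P₀.real (Z₁ ⁻¹' shrink z (h n) (dyadicCell p j)) / fz *
    ((c n j).toReal - 1), ?_, ?_⟩
  · refine tendsto_finsetSum _ fun j _ => ?_
    have hP := (((h1.2 _ (dyadicCell_mem_cubeUnions hd j)).comp hh).div_const fz)
    rw [mul_div_cancel_right₀ _ hf.ne'] at hP
    exact hP.mul (((ENNReal.tendsto_toReal ENNReal.coe_ne_top).comp (hc j)).sub_const 1)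
  · have hctop : ∀ᶠ n in atTop, ∀ j, c n j ≠ ∞ := eventually_all.2 fun j =>
      ((hc j).eventually_lt_const ENNReal.coe_lt_top).mono fun n hn => hn.ne
    have hP0 : ∀ᶠ n in atTop, ∀ j : Fin d → Fin (2 ^ p),
        P₀ (Z₁ ⁻¹' shrink z (h n) (dyadicCell p j)) ≠ 0 := eventually_all.2 fun j =>
      hh.eventually (h1.eventually_ne_zero (dyadicCell_mem_cubeUnions hd j)
        (volume_real_dyadicCell_pos j))
    filter_upwards [hpos, hctop, hP0, hspeed.eventually_gt_atTop 0] with n hn hctop hP0 hs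
    have hmeas : ∀ j : Fin d → Fin (2 ^ p), MeasurableSet (shrink z (h n) (dyadicCell p j)) :=
      fun j => measurableSet_shrink (measurableSet_dyadicCell j)
    obtain ⟨m, hm, hm1⟩ := lintegral_exp_sum_indicator (μ := P₀)
      (B := fun j : Fin d → Fin (2 ^ p) => Z₁ ⁻¹' shrink z (h n) (dyadicCell p j))
      (f := fun j ω => (fun l => t (j, l)) ⬝ᵥ Y₁ ω) (fun j => hZ₁ (hmeas j))
      (fun i j hij => (disjoint_shrink hn (pairwise_disjoint_dyadicCell hij)).preimage _)
      hP0 hctop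
    let G : (Fin k → ℝ) × (Fin d → ℝ) → ℝ≥0∞ := fun x => ENNReal.ofReal (Real.exp
      (∑ j : Fin d → Fin (2 ^ p), (shrink z (h n) (dyadicCell p j)).indicator
        (fun _ => (fun l => t (j, l)) ⬝ᵥ x.1) x.2))
    have hG : Measurable G := by
      refine (Finset.measurable_fun_sum _ fun j _ => ?_).exp.ennreal_ofReal
      have hdot : Measurable fun x : (Fin k → ℝ) × (Fin d → ℝ) => (fun l => t (j, l)) ⬝ᵥ x.1 := by
        unfold dotProduct
        fun_prop
      exact hdot.indicator (measurable_snd (hmeas j))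
    have hexp : ∀ ω, ENNReal.ofReal (Real.exp (t ⬝ᵥ (fun q =>
          poissonIncrement z fz Y Z η n (h n) (dyadicCell p q.1) ω q.2) /
            ((n : ℝ) * h n * fz)⁻¹)) =
        ∏ i ∈ Finset.range n, ∏ m ∈ Finset.range (η i ω), G (Y i m ω, Z i m ω) := fun ω => by
      rw [poissonIncrement_pairing hs.ne']
      simp only [Real.exp_sum, G]
      rw [ENNReal.ofReal_prod_of_nonneg fun i _ => Finset.prod_nonneg fun m _ =>
        Finset.prod_nonneg fun j _ => Real.exp_nonneg _]
      refine Finset.prod_congr rfl fun i _ => ?_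
      rw [ENNReal.ofReal_prod_of_nonneg fun m _ => Finset.prod_nonneg fun j _ => Real.exp_nonneg _]
    simp only [hexp]
    rw [hU.lintegral_prod_range hG (m := m) hm, hm1]
    congr 2
    rw [div_inv_eq_mul, Finset.sum_mul, Finset.mul_sum]
    refine Finset.sum_congr rfl fun j _ => ?_
    field_simp
    rfl

lemma HL2.limit_properties [IsProbabilityMeasure P₀] (hd : 1 ≤ d) (hY₁ : Measurable Y₁)
    (h1 : HL1 P₀ Z₁ z fz) (h2 : HL2 P₀ Y₁ Z₁ z LY LabsY) :
    LY 0 = 1 ∧ Continuous (fun t => (LY t : ℝ)) ∧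
      ∀ t u (σ : ℝ), 0 < σ → σ ≤ 1 → (LY (t + σ • u) : ℝ) + LY (t - σ • u) ≤
        2 * LY t + 2 * σ ^ 2 * (LY (t + (2 : ℝ) • u) + LY (t - (2 : ℝ) • u)) := by
  -- The limit `LY` does not depend on the set, so the unit cube suffices.
  have hC : dyadicCell 0 (fun _ : Fin d => 0) ∈ cubeUnions d := dyadicCell_mem_cubeUnions hd _
  have hL := (h2 _ hC).1
  refine ⟨eq_one_of_tendsto_lintegral_exp hL ?_, ?_, fun t u σ =>
    secondDifference_le_of_tendsto_lintegral_exp hY₁ hL t u⟩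
  · filter_upwards [h1.eventually_ne_zero hC (volume_real_dyadicCell_pos _)] with h hh
    exact cond_isProbabilityMeasure hh
  · rw [← continuousOn_univ]
    exact (convexOn_of_tendsto_lintegral_exp hY₁ hL).continuousOn isOpen_univ

lemma cellCumulant_zero (p : ℕ) (h0 : LY 0 = 1) : cellCumulant d p LY 0 = 0 := by
  refine Finset.sum_eq_zero fun j _ => ?_
  have : (fun l => (0 : (Fin d → Fin (2 ^ p)) × Fin k → ℝ) (j, l)) = 0 := rfl
  rw [this, h0]
  simp

lemma continuous_cellCumulant (p : ℕ) (hc : Continuous fun t => (LY t : ℝ)) :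
    Continuous (cellCumulant d p LY) := by
  refine continuous_finsetSum _ fun j _ => continuous_const.mul (Continuous.sub ?_ continuous_const)
  exact hc.comp (continuous_pi fun l => continuous_apply (j, l))

lemma cellCumulant_secondDifference_le (p : ℕ)
    (hs : ∀ t u (σ : ℝ), 0 < σ → σ ≤ 1 → (LY (t + σ • u) : ℝ) + LY (t - σ • u) ≤
      2 * LY t + 2 * σ ^ 2 * (LY (t + (2 : ℝ) • u) + LY (t - (2 : ℝ) • u)))
    (t u : (Fin d → Fin (2 ^ p)) × Fin k → ℝ) : ∃ C : ℝ, ∀ σ : ℝ, 0 < σ → σ ≤ 1 →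
      cellCumulant d p LY (t + σ • u) + cellCumulant d p LY (t - σ • u) ≤
        2 * cellCumulant d p LY t + C * σ ^ 2 := by
  let t' := fun (j : Fin d → Fin (2 ^ p)) l => t (j, l)
  let u' := fun (j : Fin d → Fin (2 ^ p)) l => u (j, l)
  refine ⟨∑ j, volume.real (dyadicCell p j) *
    (2 * (LY (t' j + (2 : ℝ) • u' j) + LY (t' j - (2 : ℝ) • u' j))), fun σ hσ hσ1 => ?_⟩
  simp only [cellCumulant]
  rw [Finset.mul_sum, Finset.sum_mul, ← Finset.sum_add_distrib, ← Finset.sum_add_distrib]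
  refine Finset.sum_le_sum fun j _ => ?_
  have h1 := mul_le_mul_of_nonneg_left (hs (t' j) (u' j) σ hσ hσ1)
    (volume_real_dyadicCell_pos j).le
  have h2 : (fun l => (t + σ • u) (j, l)) = t' j + σ • u' j := rfl
  have h3 : (fun l => (t - σ • u) (j, l)) = t' j - σ • u' j := rfl
  rw [h2, h3]
  simp only [t'] at h1 ⊢
  linarith

end PoissonIncrements

/-! ### Transfer to vector-valued arrays and conclusion. -/

/-- Currying as a homeomorphism between spaces of real arrays. -/
def curryHomeomorph (κ κ' : Type*) : (κ × κ' → ℝ) ≃ₜ (κ → κ' → ℝ) where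
  toEquiv := Equiv.curry κ κ' ℝ
  continuous_toFun := continuous_pi fun i => continuous_pi fun j => continuous_apply (i, j)
  continuous_invFun := continuous_pi fun q => (continuous_apply q.2).comp (continuous_apply q.1)


theorem lemma3p2 {k d : ℕ} (hk : 1 ≤ k) (hd : 1 ≤ d)
    {Ω₀ : Type*} [MeasurableSpace Ω₀] (P₀ : Measure Ω₀) [IsProbabilityMeasure P₀]
    (Y₁ : Ω₀ → Fin k → ℝ) (Z₁ : Ω₀ → Fin d → ℝ) (hY₁ : Measurable Y₁) (hZ₁ : Measurable Z₁)
    (z : Fin d → ℝ) (fz : ℝ) (LY : (Fin k → ℝ) → ℝ≥0) (LabsY : ℝ → ℝ≥0)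
    (h_HL1 : HL1 P₀ Z₁ z fz) (h_HL2 : HL2 P₀ Y₁ Z₁ z LY LabsY)
    {Ω : Type*} [MeasurableSpace Ω] (P : Measure Ω) [IsProbabilityMeasure P]
    (Y : ℕ → ℕ → Ω → Fin k → ℝ) (Z : ℕ → ℕ → Ω → Fin d → ℝ) (η : ℕ → Ω → ℕ)
    (hU : IsPoissonArray P P₀ Y₁ Z₁ Y Z η)
    (h : ℕ → ℝ) (h_zero : Tendsto h atTop (𝓝 0))
    (h_infty : Tendsto (fun n : ℕ => (n : ℝ) * h n) atTop atTop)
    (p : ℕ) (hp : 1 ≤ p) :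
    SatisfiesLDP P
      (fun n ω (j : Fin d → Fin (2 ^ p)) =>
        poissonIncrement z fz Y Z η n (h n) (dyadicCell p j) ω)
      (fun n : ℕ => ((n : ℝ) * h n * fz)⁻¹)
      (cellRate d p LY) := by

  obtain ⟨hL0, hLc, hLs⟩ := h_HL2.limit_properties hd hY₁ h_HL1
  exact ((hasCumulantLimit_poissonIncrement hd hZ₁ h_HL1 h_HL2 hU h_zero h_infty p).satisfiesLDP
    (continuous_cellCumulant p hLc) (cellCumulant_zero p hL0)
    (cellCumulant_secondDifference_le p hLs)).comp_homeomorph (curryHomeomorph _ _)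
    (convexConjugate_cellCumulant d p LY)
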